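/- Let $Q=[0,1]^2$ and let $B=(B(t))_{t\in Q}$ be a Brownian sheet on a probability space, i.e. an (almost surely) continuous Gaussian process with $\mathbb E B(t)=0$ and $\mathrm{Cov}(B(s),B(t))=\min(s_1,t_1)\min(s_2,t_2)$ for all $s,t\in Q$. Then, almost surely, the path $B$ belongs 1. to $S^{1/2,1/2}_{\infty,\infty}B(Q)$, 2. to $S^{1/2}_{p,\infty}B(Q)$ for all $1\le p<\infty$, and 3. to $S^{1/2}_{\Phi_2,\infty}B(Q)$. Here the spaces are defined as follows. Let $v_{-1,0}(t)=1-t$, $v_{-1,1}(t)=t$ and, for $j\ge 0$, $0\le m<2^j$, let $v_{j,m}(t)=v(2^jt-m)$ with the hat function $v(t)=\max(0,1-|2t-1|)$. For $k\in\{-1,0,1,\dots\}^2$ let $\mathcal P_k$ be the set of $m=(m_1,m_2)$ with $m_i\in\{0,1\}$ if $k_i=-1$ and $m_i\in\{0,\dots,2^{k_i}-1\}$ if $k_i\ge 0$, and let $v_{k,m}(t)=v_{k_1,m_1}(t_1)v_{k_2,m_2}(t_2)$ (the Faber system on $Q$). Consider expansions $$f=\sum_{k}\sum_{m\in\mathcal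 P_k}\lambda_{k,m}2^{-(k_1+k_2)/2}v_{k,m}\qquad(*)$$ understood as the uniform limit on $Q$, as $K\to\infty$, of the sums over $k\in\{-1,0,\dots,K\}^2$. * $S^{1/2,1/2}_{\infty,\infty}B(Q)$ consists of all $f\in C(Q)$ with an expansion $(*)$ such that $$\sup_{k}\ \max(1,k_1+k_2)^{-1/2}\ \sup_{m\in\mathcal P_k}|\lambda_{k,m}|<\infty .$$ * $S^{1/2}_{\Phi_2,\infty}B(Q)$ consists of all $f\in C(Q)$ with an expansion $(*)$ such that $$\sup_{k}\ \Bigl\|\sum_{m\in\mathcal P_k}\lambda_{k,m}\chi_{k,m}\Bigr\|_{\Phi_2}<\infty ,$$ where $\chi_{k,m}$ is the characteristic function of $I_{k_1,m_1}\times I_{k_2,m_2}$, with $I_{j,l}=[2^{-j}l,2^{-j}(l+1)]$ for $j\ge0$ and $I_{-1,0}=I_{-1,1}=[0,1]$, and $\|f\|_{\Phi_2}=\inf\{a>0:\int_Q(\exp(|f(t)|^2/a^2)-1)\,dt\le1\}$. * $S^{1/2}_{p,\infty}B(Q)$ consists of the restrictions to $Q$ (in the a.e. sense) of the functions $g\in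 L_p(\mathbb R^2)$ for which $$\|g\|_p+\sup_{0<t<1}t^{-1/2}\sup_{|h|\le t}\|\Delta^l_{h,1}g\|_p+\sup_{0<t<1}t^{-1/2}\sup_{|h|\le t}\|\Delta^l_{h,2}g\|_p+\sup_{0<t_1,t_2<1}(t_1t_2)^{-1/2}\sup_{|h_1|\le t_1,\,|h_2|\le t_2}\|\Delta^l_{h_2,2}\Delta^l_{h_1,1}g\|_p<\infty ,$$ where $\|\cdot\|_p$ is the norm of $L_p(\mathbb R^2)$ and $\Delta^l_{h,i}$ is the $l$-th order forward difference with step $h$ in the $i$-th variable; the assertion holds for every integer order $l\ge1$. -/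

import Mathlib

open MeasureTheory ProbabilityTheory Filter
open scoped ENNReal unitInterval

noncomputable section

namespace BrownianSheet

/-! The unit square `Q = [0,1]²` is the type `I × I`, where `I = unitInterval`; its measure is the
two-dimensional Lebesgue measure. -/

/-- `B = (B(t))_{t ∈ [0,1]²}` is a Brownian sheet: an (almost surely) continuous centred Gaussian
process with `Cov(B(s), B(t)) = min(s₁,t₁) · min(s₂,t₂)`. -/
structure IsBrownianSheet {Ω : Type*} [MeasurableSpace Ω] (B : I × I → Ω → ℝ) (P : Measure Ω) :
    Prop where
  gaussian : IsGaussianProcess B P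
  continuous_paths : ∀ᵐ ω ∂P, Continuous (fun t : I × I => B t ω)
  mean_zero : ∀ t : I × I, ∫ ω, B t ω ∂P = 0
  covariance : ∀ s t : I × I,
    cov[B s, B t; P] = min (s.1 : ℝ) (t.1 : ℝ) * min (s.2 : ℝ) (t.2 : ℝ)

/-! ### The Faber system -/

/-- The hat function supported in `[0,1]` with `hat (1/2) = 1`. -/
def hat (t : ℝ) : ℝ := max 0 (1 - |2 * t - 1|)

/-- The univariate Faber system, indexed by the levels `j = -1, 0, 1, …`:
`v_{-1,0}(t) = 1 - t`, `v_{-1,1}(t) = t`, and `v_{j,m}(t) = hat (2^j t - m)` for `j ≥ 0`. -/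
def faber (j : ℤ) (m : ℕ) (t : ℝ) : ℝ :=
  if j = -1 then (if m = 0 then 1 - t else t) else hat ((2 : ℝ) ^ j * t - m)

/-- Admissible translations at level `j`: `{0,1}` for `j = -1`, and `{0,…,2^j-1}` for `j ≥ 0`. -/
def translations (j : ℤ) : Finset ℕ :=
  if j = -1 then Finset.range 2 else Finset.range (2 ^ j.toNat)

/-- The set `𝒫_k` of admissible translations `m = (m₁,m₂)` at level `k = (k₁,k₂)`. -/
def translations₂ (k : ℤ × ℤ) : Finset (ℕ × ℕ) := translations k.1 ×ˢ translations k.2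

/-- The index set `{-1,0,1,…}²` of levels. -/
def levels : Set (ℤ × ℤ) := {k | -1 ≤ k.1 ∧ -1 ≤ k.2}

/-- The tensor product Faber function `v_{k,m}(x) = v_{k₁,m₁}(x₁) v_{k₂,m₂}(x₂)` on the square. -/
def faber₂ (k : ℤ × ℤ) (m : ℕ × ℕ) (x : I × I) : ℝ :=
  faber k.1 m.1 (x.1 : ℝ) * faber k.2 m.2 (x.2 : ℝ)

/-- The partial sum over `k ∈ {-1,…,K}²` and `m ∈ 𝒫_k` of `c_{k,m} 2^{-(k₁+k₂) r} v_{k,m}`. -/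
def faberSum (r : ℝ) (c : ℤ × ℤ → ℕ × ℕ → ℝ) (K : ℕ) (x : I × I) : ℝ :=
  ∑ k ∈ Finset.Icc (-1 : ℤ) K ×ˢ Finset.Icc (-1 : ℤ) K, ∑ m ∈ translations₂ k,
    c k m * (2 : ℝ) ^ (-((k.1 + k.2 : ℤ) : ℝ) * r) * faber₂ k m x

/-- `f = ∑_k ∑_{m ∈ 𝒫_k} c_{k,m} 2^{-(k₁+k₂) r} v_{k,m}`, as a uniform limit on the square. -/
def HasFaberExpansion (r : ℝ) (f : I × I → ℝ) (c : ℤ × ℤ → ℕ × ℕ → ℝ) : Prop :=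
  TendstoUniformly (faberSum r c) f atTop

/-! ### The space of logarithmic dominating mixed smoothness -/

/-- The sequence space norm with `p = q = ∞`:
`sup_k max(1, k₁+k₂)^{-α} sup_{m ∈ 𝒫_k} |c_{k,m}|`. -/
def logSeqNorm (α : ℝ) (c : ℤ × ℤ → ℕ × ℕ → ℝ) : ℝ≥0∞ :=
  ⨆ k ∈ levels, ENNReal.ofReal ((max 1 ((k.1 + k.2 : ℤ) : ℝ)) ^ (-α)) *
    ⨆ m ∈ translations₂ k, ‖c k m‖ₑ

/-- The space `S^{1/2,α}_{∞,∞}B(Q)`. -/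
def logMixedSpace (α : ℝ) : Set (I × I → ℝ) :=
  {f | Continuous f ∧ ∃ c : ℤ × ℤ → ℕ × ℕ → ℝ,
    HasFaberExpansion (1 / 2) f c ∧ logSeqNorm α c < ∞}

/-! ### The Besov space of dominating mixed smoothness -/

/-- For `g : ℝ² → ℝ`, the norm of `S^r_{p,∞}B(ℝ²)` by differences of order `l`. Here
`(fwdDiff (h, 0))^[l] g` and `(fwdDiff (0, h))^[l] g` are the `l`-th differences in the first and
in the second variable. -/
def mixedBesovNorm (r : ℝ) (p : ℝ≥0∞) (l : ℕ) (g : ℝ × ℝ → ℝ) : ℝ≥0∞ :=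
  eLpNorm g p volume
  + (⨆ t ∈ Set.Ioo (0 : ℝ) 1, ENNReal.ofReal (t ^ (-r)) *
      ⨆ (h : ℝ) (_ : |h| ≤ t), eLpNorm ((fwdDiff (h, (0 : ℝ)))^[l] g) p volume)
  + (⨆ t ∈ Set.Ioo (0 : ℝ) 1, ENNReal.ofReal (t ^ (-r)) *
      ⨆ (h : ℝ) (_ : |h| ≤ t), eLpNorm ((fwdDiff ((0 : ℝ), h))^[l] g) p volume)
  + (⨆ t₁ ∈ Set.Ioo (0 : ℝ) 1, ⨆ t₂ ∈ Set.Ioo (0 : ℝ) 1, ENNReal.ofReal ((t₁ * t₂) ^ (-r)) *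
      ⨆ (h₁ : ℝ) (_ : |h₁| ≤ t₁) (h₂ : ℝ) (_ : |h₂| ≤ t₂),
        eLpNorm ((fwdDiff ((0 : ℝ), h₂))^[l] ((fwdDiff (h₁, (0 : ℝ)))^[l] g)) p volume)

/-- The space `S^r_{p,∞}B(Q)`, defined by restriction: `f` agrees almost everywhere on `Q` with some
`g ∈ S^r_{p,∞}B(ℝ²)`. The differences are of order `l`, where `0 < r < l`. -/
def mixedBesovSpace (r : ℝ) (p : ℝ≥0∞) (l : ℕ) : Set (I × I → ℝ) :=
  {f | ∃ g : ℝ × ℝ → ℝ, AEStronglyMeasurable g volume ∧ mixedBesovNorm r p l g < ∞ ∧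
    ∀ᵐ x : I × I, f x = g ((x.1 : ℝ), (x.2 : ℝ))}

/-! ### The Besov-Orlicz space of dominating mixed smoothness -/

/-- The Young function `Φ₂(t) = exp(t²) - 1`. -/
def Φ₂ (t : ℝ) : ℝ := Real.exp (t ^ 2) - 1

/-- The Luxemburg norm `inf {a > 0 : ∫_Q Φ₂(|f|/a) ≤ 1}` (equal to `∞` if there is no such `a`). -/
def orliczNorm (f : I × I → ℝ) : ℝ≥0∞ :=
  ⨅ (a : ℝ) (_ : 0 < a) (_ : ∫⁻ x : I × I, ENNReal.ofReal (Φ₂ (|f x| / a)) ≤ 1), ENNReal.ofReal a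

/-- The interval `I_{j,m} = [2^{-j} m, 2^{-j} (m+1)]` for `j ≥ 0`, and `I_{-1,m} = [0,1]`. -/
def dyadic (j : ℤ) (m : ℕ) : Set ℝ :=
  if j = -1 then Set.Icc 0 1 else Set.Icc ((2 : ℝ) ^ (-j) * m) ((2 : ℝ) ^ (-j) * (m + 1))

/-- The step function `∑_{m ∈ 𝒫_k} c_{k,m} χ_{k,m}`, with `χ_{k,m}` the characteristic function of
`I_{k₁,m₁} × I_{k₂,m₂}`. -/
def levelStep (c : ℤ × ℤ → ℕ × ℕ → ℝ) (k : ℤ × ℤ) (x : I × I) : ℝ :=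
  ∑ m ∈ translations₂ k,
    c k m * (dyadic k.1 m.1).indicator 1 (x.1 : ℝ) * (dyadic k.2 m.2).indicator 1 (x.2 : ℝ)

/-- The sequence space norm `sup_k ‖∑_{m ∈ 𝒫_k} c_{k,m} χ_{k,m}‖_{Φ₂}`. -/
def orliczSeqNorm (c : ℤ × ℤ → ℕ × ℕ → ℝ) : ℝ≥0∞ :=
  ⨆ k ∈ levels, orliczNorm (levelStep c k)

/-- The space `S^{1/2}_{Φ₂,∞}B(Q)`. -/
def orliczMixedSpace : Set (I × I → ℝ) :=
  {f | Continuous f ∧ ∃ c : ℤ × ℤ → ℕ × ℕ → ℝ,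
    HasFaberExpansion (1 / 2) f c ∧ orliczSeqNorm c < ∞}

end BrownianSheet

end

/-! All three memberships follow from one almost sure bound. Write λ_{k,m} for the Faber
coefficients of a path and μ_k for the exponential mean |cell_k| · Σ_m exp(λ_{k,m}²/16) (`expMean`,
`cellVol`). The claim is that almost surely sup_k μ_k < ∞.

Probability. The λ_{k,m} are scaled mixed second differences of the sheet (point values at level
-1). The covariance is a product of two kernels min(s,t), so their Gram matrix factorises; within
one level k they are centred Gaussian, pairwise uncorrelated, hence pairwise independent, with
variance at most 1 (`gram_eq_zero`, `gram_self`, `IsBrownianSheet.covariance_faberCoeff`). Thus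
exp(λ²/16) has bounded second moment, E μ_k ≤ 8 and Var μ_k ≤ 8|cell_k|. Chebyshev gives P(μ_k ≥ 9)
≤ 8|cell_k|, which is summable over k, and Borel–Cantelli finishes
(`IsBrownianSheet.exists_expMean_le`).

Analysis, path by path. The partial Faber sums are dyadic piecewise linear interpolants, so they
converge uniformly for continuous paths. A single term of μ_k gives λ² ≲ max(1, k₁+k₂), the
logarithmic space. Up to the bounded overlap of the closed cells, μ_k dominates the integral in the
Luxemburg norm, the Orlicz space. For the Besov space, expanding exp shows that the p-th power means
of the λ_{k,m} are bounded in k. The path is extended to the plane by replacing each Faber function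
by a full hat; Schur's test bounds each level in L_p, and a difference with step h gains min(1,
2·2^j|h|) in its variable. Since Σ_j 2^{-j/2} min(1, 2^j|h|) ≲ |h|^{1/2}, the sums over levels have
smoothness exactly 1/2 in each variable separately (`mem_mixedBesovSpace`). -/

namespace BrownianSheet

/-! ### Faber coefficients and uniform convergence of the Faber expansion -/

/-- Weights of the functional which gives the Faber coefficient of level `j`. -/
noncomputable def weight (j : ℤ) : Fin 3 → ℝ := if j = -1 then ![0, 1, 0] else ![-1 / 2, 1, -1 / 2]

/-- Nodes of the functional which gives the Faber coefficient with index `(j, m)`. -/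
noncomputable def node (j : ℤ) (m : ℕ) (a : Fin 3) : ℝ :=
  if j = -1 then m else (m + (a : ℕ) / 2) / (2 : ℝ) ^ j

/-- The piecewise linear interpolation of `g` at the points of `2⁻ⁿ ℤ`. -/
noncomputable def interp (n : ℕ) (g : ℝ → ℝ) (t : ℝ) : ℝ :=
  (1 - ((2 : ℝ) ^ n * t - ⌊(2 : ℝ) ^ n * t⌋₊)) * g (⌊(2 : ℝ) ^ n * t⌋₊ / (2 : ℝ) ^ n) +
    ((2 : ℝ) ^ n * t - ⌊(2 : ℝ) ^ n * t⌋₊) * g ((⌊(2 : ℝ) ^ n * t⌋₊ + 1) / (2 : ℝ) ^ n)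

/-! ### The hat function -/

lemma hat_nonneg (t : ℝ) : 0 ≤ hat t := le_max_left _ _

lemma hat_le_one (t : ℝ) : hat t ≤ 1 :=
  max_le zero_le_one (by linarith [abs_nonneg (2 * t - 1)])

lemma hat_eq_zero_of_nonpos {t : ℝ} (ht : t ≤ 0) : hat t = 0 := by
  unfold hat
  rw [abs_of_nonpos (by linarith)]
  exact max_eq_left (by linarith)

lemma hat_eq_zero_of_one_le {t : ℝ} (ht : 1 ≤ t) : hat t = 0 := by
  unfold hat
  rw [abs_of_nonneg (by linarith)]
  exact max_eq_left (by linarith)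

lemma hat_of_le_half {t : ℝ} (h₀ : 0 ≤ t) (h₁ : t ≤ 1 / 2) : hat t = 2 * t := by
  unfold hat
  rw [abs_of_nonpos (by linarith), max_eq_right] <;> linarith

lemma hat_of_half_le {t : ℝ} (h₀ : 1 / 2 ≤ t) (h₁ : t ≤ 1) : hat t = 2 - 2 * t := by
  unfold hat
  rw [abs_of_nonneg (by linarith), max_eq_right] <;> linarith

lemma translations_natCast (n : ℕ) : translations (n : ℤ) = Finset.range (2 ^ n) := by
  unfold translations
  rw [if_neg (by omega)]
  simp

/-- Hats of one level have disjoint interiors of their supports, so only the cell that contains t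
contributes. -/
lemma sum_level_eq (n : ℕ) (g : ℝ → ℝ) {t : ℝ} (ht : t ∈ Set.Icc (0 : ℝ) 1) :
    ∑ m ∈ translations n, (∑ a, weight n a * g (node n m a)) * faber n m t =
      (∑ a, weight n a * g (node n ⌊(2 : ℝ) ^ n * t⌋₊ a)) *
        hat ((2 : ℝ) ^ n * t - ⌊(2 : ℝ) ^ n * t⌋₊) := by
  have hx : 0 ≤ (2 : ℝ) ^ n * t := mul_nonneg (by positivity) ht.1
  have h1 := Nat.floor_le hx
  have h2 := Nat.lt_floor_add_one ((2 : ℝ) ^ n * t)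
  have hf : ∀ m : ℕ, faber n m t = hat ((2 : ℝ) ^ n * t - m) := fun m => by
    unfold faber
    rw [if_neg (by omega), zpow_natCast]
  simp_rw [hf, translations_natCast]
  apply Finset.sum_eq_single
  · intro m _ hm
    rcases lt_or_gt_of_ne hm with h | h
    · have : (m : ℝ) + 1 ≤ ⌊(2 : ℝ) ^ n * t⌋₊ := by exact_mod_cast h
      rw [hat_eq_zero_of_one_le (by linarith), mul_zero]
    · have : (⌊(2 : ℝ) ^ n * t⌋₊ : ℝ) + 1 ≤ m := by exact_mod_cast h
      rw [hat_eq_zero_of_nonpos (by linarith), mul_zero]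
  -- Only t = 1 reaches this case: its floor 2^n is not an admissible translation, but the hat
  -- vanishes at 0.
  · intro h
    have h3 : ((2 : ℝ) ^ n) ≤ ⌊(2 : ℝ) ^ n * t⌋₊ := by
      exact_mod_cast not_lt.1 (fun h' => h (Finset.mem_range.2 h'))
    have h4 : (2 : ℝ) ^ n * t ≤ 2 ^ n := mul_le_of_le_one_right (by positivity) ht.2
    rw [hat_eq_zero_of_nonpos (by linarith), mul_zero]

/-- Halving the mesh changes the interpolant on a cell only through the value at the midpoint, so
the correction is the hat times the second difference there. The two cases are the halves of the
cell. -/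
lemma interp_succ (n : ℕ) (g : ℝ → ℝ) {t : ℝ} (ht : 0 ≤ t) :
    interp (n + 1) g t = interp n g t + (∑ a, weight n a * g (node n ⌊(2 : ℝ) ^ n * t⌋₊ a)) *
        hat ((2 : ℝ) ^ n * t - ⌊(2 : ℝ) ^ n * t⌋₊) := by
  have hx : 0 ≤ (2 : ℝ) ^ n * t := mul_nonneg (by positivity) ht
  have h1 := Nat.floor_le hx
  have h2 := Nat.lt_floor_add_one ((2 : ℝ) ^ n * t)
  have hN : (0 : ℝ) < 2 ^ n := by positivity
  have hw : ((n : ℤ) = -1) = False := by simp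
  have e1 : ∀ l : ℝ, (2 * l) / (2 ^ n * 2 : ℝ) = l / 2 ^ n := fun l => by field_simp
  have e2 : ∀ l : ℝ, (2 * l + 1) / (2 ^ n * 2 : ℝ) = (l + 1 / 2) / 2 ^ n := fun l => by field_simp
  have e3 : ∀ l : ℝ, (2 * l + 1 + 1) / (2 ^ n * 2 : ℝ) = (l + 1) / 2 ^ n := fun l => by
    ring
  unfold interp weight node
  simp only [hw, if_false, Fin.sum_univ_three, zpow_natCast]
  set l := ⌊(2 : ℝ) ^ n * t⌋₊ with hl
  by_cases hθ : (2 : ℝ) ^ n * t - l < 1 / 2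
  · have h3 : ⌊(2 : ℝ) ^ (n + 1) * t⌋₊ = 2 * l := by
      rw [Nat.floor_eq_iff (by positivity)]
      push_cast
      rw [pow_succ]
      constructor <;> linarith
    rw [h3, hat_of_le_half (by linarith) hθ.le]
    push_cast
    simp [pow_succ, e1, e2]
    ring_nf
  · have h3 : ⌊(2 : ℝ) ^ (n + 1) * t⌋₊ = 2 * l + 1 := by
      rw [Nat.floor_eq_iff (by positivity)]
      push_cast
      rw [pow_succ]
      constructor <;> linarith
    rw [h3, hat_of_half_le (by linarith) (by linarith)]
    push_cast
    simp [pow_succ, e2, e3]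
    ring_nf

/-- The univariate Faber partial sums are the interpolation operators. -/
lemma sum_faber_eq_interp (n : ℕ) (g : ℝ → ℝ) {t : ℝ} (ht : t ∈ Set.Icc (0 : ℝ) 1) :
    ∑ j ∈ Finset.Icc (-1 : ℤ) ((n : ℤ) - 1), ∑ m ∈ translations j,
      (∑ a, weight j a * g (node j m a)) * faber j m t = interp n g t := by
  induction n with
  | zero =>
    simp only [Nat.cast_zero, zero_sub, Finset.Icc_self, Finset.sum_singleton]
    simp only [translations, weight, node, faber, if_true, Finset.sum_range_succ,
      Finset.sum_range_zero, Fin.sum_univ_three]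
    unfold interp
    rcases ht.2.eq_or_lt with rfl | h
    · simp
    · have : ⌊t⌋₊ = 0 := Nat.floor_eq_zero.2 h
      simp [this]
      ring
  | succ n ih =>
    have : Finset.Icc (-1 : ℤ) (((n + 1 : ℕ) : ℤ) - 1) =
        insert (n : ℤ) (Finset.Icc (-1 : ℤ) ((n : ℤ) - 1)) := by
      ext j; simp only [Finset.mem_Icc, Finset.mem_insert]; push_cast; omega
    rw [this, Finset.sum_insert (by simp), ih, sum_level_eq n g ht, interp_succ n g ht.1, add_comm]

/-- The interpolant at t is a convex combination of the values at two nodes within 2^{-n} of t. -/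
lemma abs_interp_sub_le {n : ℕ} {g : ℝ → ℝ} {t y ε : ℝ} (ht : 0 ≤ t)
    (hg : ∀ s, |s - t| ≤ ((2 : ℝ) ^ n)⁻¹ → |g s - y| ≤ ε) : |interp n g t - y| ≤ ε := by
  have hN : (0 : ℝ) < 2 ^ n := by positivity
  have hx : 0 ≤ (2 : ℝ) ^ n * t := by positivity
  have h1 := Nat.floor_le hx
  have h2 := Nat.lt_floor_add_one ((2 : ℝ) ^ n * t)
  unfold interp
  set l := ⌊(2 : ℝ) ^ n * t⌋₊
  have key : ∀ z : ℝ, |z - 2 ^ n * t| ≤ 1 → |g (z / 2 ^ n) - y| ≤ ε := fun z hz => by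
    apply hg
    have : z / 2 ^ n - t = (z - 2 ^ n * t) * ((2 : ℝ) ^ n)⁻¹ := by field_simp
    rw [this, abs_mul, abs_of_pos (inv_pos.2 hN)]
    exact mul_le_of_le_one_left (by positivity) hz
  have k1 := abs_le.1 (key l (abs_le.2 ⟨by linarith, by linarith⟩))
  have k2 := abs_le.1 (key (l + 1) (abs_le.2 ⟨by linarith, by linarith⟩))
  set θ := (2 : ℝ) ^ n * t - l
  have hθ0 : 0 ≤ θ := by simp only [θ]; linarith
  have hθ1 : 0 ≤ 1 - θ := by simp only [θ]; linarith
  rw [abs_le]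
  constructor <;> nlinarith

/-- The nodes as points of the unit interval. -/
noncomputable def inode (j : ℤ) (m : ℕ) (a : Fin 3) : I :=
  Set.projIcc 0 1 zero_le_one (node j m a)

/-- The tensor product second differences which give the Faber coefficients of `f`. -/
noncomputable def mixedDiff (f : I × I → ℝ) (k : ℤ × ℤ) (m : ℕ × ℕ) : ℝ :=
  ∑ a, ∑ b, weight k.1 a * weight k.2 b * f (inode k.1 m.1 a, inode k.2 m.2 b)

/-- The coefficients of the Faber expansion of `f`, with the normalisation for `r = 1/2`. -/
noncomputable def faberCoeff (f : I × I → ℝ) (k : ℤ × ℤ) (m : ℕ × ℕ) : ℝ :=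
  (2 : ℝ) ^ (((k.1 + k.2 : ℤ) : ℝ) / 2) * mixedDiff f k m

/-- The univariate identity applied in each variable; the factors 2^{±(k₁+k₂)/2} cancel. Levels -1,
…, K correspond to mesh 2^{-(K+1)}. -/
lemma faberSum_faberCoeff (f : I × I → ℝ) (K : ℕ) (x : I × I) :
    faberSum (1 / 2) (faberCoeff f) K x =
      interp (K + 1) (fun s => interp (K + 1) (fun t =>
        f (Set.projIcc 0 1 zero_le_one s, Set.projIcc 0 1 zero_le_one t)) x.2) x.1 := by
  rw [← sum_faber_eq_interp _ _ x.1.2]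
  simp_rw [← sum_faber_eq_interp _ _ x.2.2]
  have h2 : ∀ k : ℤ × ℤ, (2 : ℝ) ^ (((k.1 + k.2 : ℤ) : ℝ) / 2) *
      (2 : ℝ) ^ (-((k.1 + k.2 : ℤ) : ℝ) * (1 / 2)) = 1 := fun k => by
    rw [← Real.rpow_add two_pos]
    ring_nf
    simp
  unfold faberSum
  rw [Finset.sum_product, Nat.cast_add, Nat.cast_one, add_sub_cancel_right]
  refine Finset.sum_congr rfl fun j₁ _ => ?_
  simp_rw [translations₂, Finset.sum_product]
  rw [Finset.sum_comm]
  refine Finset.sum_congr rfl fun m₁ _ => ?_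
  simp_rw [Finset.mul_sum, Finset.sum_mul]
  refine Eq.trans ?_ Finset.sum_comm
  refine Finset.sum_congr rfl fun j₂ _ => ?_
  refine Eq.trans ?_ Finset.sum_comm
  refine Finset.sum_congr rfl fun m₂ _ => ?_
  have h3 := h2 (j₁, j₂)
  simp only at h3
  unfold faberCoeff mixedDiff faber₂
  simp only
  rw [mul_right_comm _ _ ((2 : ℝ) ^ _), h3, one_mul]
  simp_rw [Finset.sum_mul]
  refine Finset.sum_congr rfl fun a _ => ?_
  rw [Finset.mul_sum, Finset.sum_mul]
  refine Finset.sum_congr rfl fun b _ => ?_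
  unfold inode
  ring

/-- A continuous function on the square is the uniform limit of its Faber partial sums. -/
theorem hasFaberExpansion_faberCoeff {f : I × I → ℝ} (hf : Continuous f) :
    HasFaberExpansion (1 / 2) f (faberCoeff f) := by
  have huc : UniformContinuous f := CompactSpace.uniformContinuous_of_continuous hf
  unfold HasFaberExpansion
  rw [Metric.tendstoUniformly_iff]
  intro ε hε
  obtain ⟨δ, hδ, H⟩ := Metric.uniformContinuous_iff.1 huc (ε / 2) (half_pos hε)
  obtain ⟨n, hn⟩ := exists_pow_lt_of_lt_one hδ (by norm_num : (1 / 2 : ℝ) < 1)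
  filter_upwards [eventually_ge_atTop n] with K hK x
  rw [dist_comm, Real.dist_eq, faberSum_faberCoeff]
  refine lt_of_le_of_lt ?_ (half_lt_self hε)
  have hlt : ((2 : ℝ) ^ (K + 1))⁻¹ < δ := by
    rw [← inv_pow, ← one_div]
    exact lt_of_le_of_lt (pow_le_pow_of_le_one (by norm_num) (by norm_num) (by omega)) hn
  have hproj : ∀ (s : ℝ) (y : I), |s - y| < δ → dist (Set.projIcc 0 1 zero_le_one s) y < δ := by
    intro s y h
    have : dist (Set.projIcc (0 : ℝ) 1 zero_le_one s)
        (Set.projIcc (0 : ℝ) 1 zero_le_one (y : ℝ)) ≤ dist s y := by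
      simpa using (LipschitzWith.projIcc (zero_le_one (α := ℝ))).dist_le_mul s y
    rw [Set.projIcc_val] at this
    exact lt_of_le_of_lt this h
  refine abs_interp_sub_le x.1.2.1 fun s hs => abs_interp_sub_le x.2.2.1 fun t ht => ?_
  rw [← Real.dist_eq]
  refine (H ?_).le
  rw [Prod.dist_eq]
  exact max_lt (hproj _ _ (hs.trans_lt hlt)) (hproj _ _ (ht.trans_lt hlt))

/-! ### The logarithmic space and the Orlicz space from exponential means of the coefficients -/

/-- The area of the dyadic rectangles of level `k`. -/
noncomputable def cellVol (k : ℤ × ℤ) : ℝ := (1 / 2) ^ k.1.toNat * (1 / 2) ^ k.2.toNat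

/-- The exponential square mean of the coefficients of level `k`. -/
noncomputable def expMean (c : ℤ × ℤ → ℕ × ℕ → ℝ) (k : ℤ × ℤ) : ℝ :=
  cellVol k * ∑ m ∈ translations₂ k, Real.exp ((c k m) ^ 2 / 16)

lemma cellVol_pos (k : ℤ × ℤ) : 0 < cellVol k := by
  unfold cellVol; positivity

lemma card_translations_le (j : ℤ) : (translations j).card ≤ 2 * 2 ^ j.toNat := by
  unfold translations
  split_ifs with h
  · simp [h]
  · simp

/-- A factor 2 is lost in each variable at level -1, where two translations share the interval
[0,1]. -/
lemma cellVol_mul_card_le (k : ℤ × ℤ) : cellVol k * (translations₂ k).card ≤ 4 := by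
  have h1 : ((translations k.1).card : ℝ) ≤ 2 * 2 ^ k.1.toNat := by
    exact_mod_cast card_translations_le k.1
  have h2 : ((translations k.2).card : ℝ) ≤ 2 * 2 ^ k.2.toNat := by
    exact_mod_cast card_translations_le k.2
  have e : ∀ n : ℕ, (1 / 2 : ℝ) ^ n * 2 ^ n = 1 := fun n => by rw [← mul_pow]; norm_num
  unfold cellVol translations₂
  rw [Finset.card_product]
  push_cast
  calc _ ≤ (1 / 2 : ℝ) ^ k.1.toNat * (1 / 2) ^ k.2.toNat *
        ((2 * 2 ^ k.1.toNat) * (2 * 2 ^ k.2.toNat)) := by gcongr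
    _ = 4 * ((1 / 2 : ℝ) ^ k.1.toNat * 2 ^ k.1.toNat) * ((1 / 2) ^ k.2.toNat * 2 ^ k.2.toNat) := by
      ring
    _ = 4 := by rw [e, e]; norm_num

/-- One term of the mean is at most M divided by the cell area, and the logarithm of that is linear
in k₁+k₂. The 3 absorbs the shift by 2 caused by the levels -1. -/
lemma sq_le_of_expMean_le {c : ℤ × ℤ → ℕ × ℕ → ℝ} {M : ℝ} (hM : 1 ≤ M) {k : ℤ × ℤ}
    (hk : k ∈ levels) (hc : expMean c k ≤ M) {m : ℕ × ℕ} (hm : m ∈ translations₂ k) :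
    (c k m) ^ 2 ≤ 16 * (Real.log M + 3) * max 1 ((k.1 + k.2 : ℤ) : ℝ) := by
  obtain ⟨hk1, hk2⟩ := hk
  have h1 : Real.exp ((c k m) ^ 2 / 16) ≤ M * 2 ^ (k.1.toNat + k.2.toNat) := by
    have h2 : cellVol k * Real.exp ((c k m) ^ 2 / 16) ≤ M := by
      refine le_trans ?_ hc
      unfold expMean
      gcongr
      · exact (cellVol_pos k).le
      · exact Finset.single_le_sum (f := fun m => Real.exp ((c k m) ^ 2 / 16))
          (fun _ _ => (Real.exp_pos _).le) hm
    have h3 : cellVol k * 2 ^ (k.1.toNat + k.2.toNat) = 1 := by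
      unfold cellVol
      rw [← pow_add, ← mul_pow]
      norm_num
    calc Real.exp ((c k m) ^ 2 / 16)
        = (cellVol k * Real.exp ((c k m) ^ 2 / 16)) * 2 ^ (k.1.toNat + k.2.toNat) := by
          rw [mul_right_comm, h3, one_mul]
      _ ≤ _ := by gcongr
  have h4 := Real.log_le_log (Real.exp_pos _) h1
  rw [Real.log_exp, Real.log_mul (by positivity) (by positivity), Real.log_pow] at h4
  have h5 : ((k.1.toNat + k.2.toNat : ℕ) : ℝ) ≤ ((k.1 + k.2 : ℤ) : ℝ) + 2 := by
    have : ((k.1.toNat + k.2.toNat : ℕ) : ℤ) ≤ k.1 + k.2 + 2 := by omega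
    exact_mod_cast this
  have h6 : ((k.1.toNat + k.2.toNat : ℕ) : ℝ) * Real.log 2 ≤ (k.1.toNat + k.2.toNat : ℕ) :=
    mul_le_of_le_one_right (by positivity) (by linarith [Real.log_two_lt_d9])
  have h7 := Real.log_nonneg hM
  have h8 := le_max_left 1 ((k.1 + k.2 : ℤ) : ℝ)
  have h9 := le_max_right 1 ((k.1 + k.2 : ℤ) : ℝ)
  nlinarith

theorem logSeqNorm_lt_top {c : ℤ × ℤ → ℕ × ℕ → ℝ} {M : ℝ} (hM : 1 ≤ M)
    (hc : ∀ k ∈ levels, expMean c k ≤ M) : logSeqNorm (1 / 2) c < ∞ := by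
  refine lt_of_le_of_lt (b := ENNReal.ofReal (Real.sqrt (16 * (Real.log M + 3)))) ?_
    ENNReal.ofReal_lt_top
  refine iSup₂_le fun k hk => ?_
  simp_rw [ENNReal.mul_iSup]
  refine iSup₂_le fun m hm => ?_
  have hx : 0 < max 1 ((k.1 + k.2 : ℤ) : ℝ) := lt_of_lt_of_le one_pos (le_max_left _ _)
  rw [← ofReal_norm, ← ENNReal.ofReal_mul (by positivity)]
  apply ENNReal.ofReal_le_ofReal
  have h1 : ‖c k m‖ ≤ Real.sqrt (16 * (Real.log M + 3)) *
      (max 1 ((k.1 + k.2 : ℤ) : ℝ)) ^ (1 / 2 : ℝ) := by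
    rw [← Real.sqrt_eq_rpow, ← Real.sqrt_mul (by linarith [Real.log_nonneg hM])]
    exact Real.abs_le_sqrt (sq_le_of_expMean_le hM hk (hc k hk) hm)
  calc _ ≤ (max 1 ((k.1 + k.2 : ℤ) : ℝ)) ^ (-(1 / 2) : ℝ) *
        (Real.sqrt (16 * (Real.log M + 3)) * (max 1 ((k.1 + k.2 : ℤ) : ℝ)) ^ (1 / 2 : ℝ)) := by
        gcongr
    _ = _ := by
        rw [mul_left_comm, ← Real.rpow_add hx]
        simp

/-- The intervals are closed, so neighbours share an endpoint; at level -1 both translations carry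
the same interval. -/
lemma card_filter_dyadic_le (j : ℤ) (t : ℝ) [DecidablePred fun m => t ∈ dyadic j m] :
    ((translations j).filter fun m => t ∈ dyadic j m).card ≤ 2 := by
  by_cases hj : j = -1
  · refine (Finset.card_filter_le _ _).trans ?_
    simp [translations, hj]
  · refine (Finset.card_le_card (t := {⌊(2 : ℝ) ^ j * t⌋₊, ⌊(2 : ℝ) ^ j * t⌋₊ - 1}) ?_).trans
      Finset.card_le_two
    intro m hm
    have hm2 := (Finset.mem_filter.1 hm).2
    unfold dyadic at hm2
    rw [if_neg hj, zpow_neg, Set.mem_Icc, inv_mul_le_iff₀ (by positivity),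
      le_inv_mul_iff₀ (by positivity)] at hm2
    have h1 := Nat.floor_le (le_trans (Nat.cast_nonneg m) hm2.1)
    have h2 := Nat.lt_floor_add_one ((2 : ℝ) ^ j * t)
    have h3 : m ≤ ⌊(2 : ℝ) ^ j * t⌋₊ := Nat.le_floor hm2.1
    have h4 : ⌊(2 : ℝ) ^ j * t⌋₊ ≤ m + 1 := by
      have : (⌊(2 : ℝ) ^ j * t⌋₊ : ℝ) ≤ ((m + 1 : ℕ) : ℝ) := by push_cast; linarith
      exact_mod_cast this
    simp only [Finset.mem_insert, Finset.mem_singleton]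
    omega

lemma measurableSet_dyadic (j : ℤ) (m : ℕ) : MeasurableSet (dyadic j m) := by
  unfold dyadic
  split_ifs <;> exact measurableSet_Icc

/-- The rectangle `I_{k₁,m₁} × I_{k₂,m₂}` as a subset of the square. -/
def cell (k : ℤ × ℤ) (m : ℕ × ℕ) : Set (I × I) :=
  ((↑) ⁻¹' dyadic k.1 m.1) ×ˢ ((↑) ⁻¹' dyadic k.2 m.2)

lemma measurableSet_cell (k : ℤ × ℤ) (m : ℕ × ℕ) : MeasurableSet (cell k m) :=
  (measurable_subtype_coe (measurableSet_dyadic _ _)).prod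
    (measurable_subtype_coe (measurableSet_dyadic _ _))

lemma volume_preimage_dyadic_le {j : ℤ} (hj : -1 ≤ j) (m : ℕ) :
    volume ((↑) ⁻¹' dyadic j m : Set I) ≤ ENNReal.ofReal ((1 / 2) ^ j.toNat) := by
  rw [unitInterval.volume_apply]
  refine (measure_mono (Set.image_preimage_subset _ _)).trans ?_
  unfold dyadic
  split_ifs with h
  · simp [h]
  · rw [Real.volume_Icc]
    apply ENNReal.ofReal_le_ofReal
    obtain ⟨n, rfl⟩ := Int.eq_ofNat_of_zero_le (show 0 ≤ j by omega)
    simp only [zpow_neg, zpow_natCast, Int.toNat_natCast, one_div, inv_pow]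
    exact le_of_eq (by ring)

lemma volume_cell_le {k : ℤ × ℤ} (hk : k ∈ levels) (m : ℕ × ℕ) :
    volume (cell k m) ≤ ENNReal.ofReal (cellVol k) := by
  unfold cell cellVol
  rw [Measure.volume_eq_prod, Measure.prod_prod, ENNReal.ofReal_mul (by positivity)]
  exact mul_le_mul' (volume_preimage_dyadic_le hk.1 _) (volume_preimage_dyadic_le hk.2 _)

/-- At most 2 · 2 cells meet at a point, so the step function is at most 4 times the largest
coefficient there; 256 = 16 · 4². Subtracting 1 covers points in no cell. -/
lemma exp_levelStep_le (c : ℤ × ℤ → ℕ × ℕ → ℝ) (k : ℤ × ℤ) (x : I × I) :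
    Real.exp ((levelStep c k x) ^ 2 / 256) - 1 ≤
      ∑ m ∈ translations₂ k, (cell k m).indicator (fun _ => Real.exp ((c k m) ^ 2 / 16)) x := by
  classical
  have hnn : ∀ m ∈ translations₂ k,
      0 ≤ (cell k m).indicator (fun _ => Real.exp ((c k m) ^ 2 / 16)) x := fun m _ =>
    Set.indicator_nonneg (fun _ _ => (Real.exp_pos _).le) _
  set A := (translations₂ k).filter fun m => x ∈ cell k m with hA
  have hS : levelStep c k x = ∑ m ∈ A, c k m := by
    unfold levelStep
    rw [hA, Finset.sum_filter]
    refine Finset.sum_congr rfl fun m _ => ?_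
    by_cases h1 : (x.1 : ℝ) ∈ dyadic k.1 m.1 <;> by_cases h2 : (x.2 : ℝ) ∈ dyadic k.2 m.2 <;>
      simp [cell, h1, h2]
  have hcard : A.card ≤ 4 := by
    have : A ⊆ ((translations k.1).filter fun m => (x.1 : ℝ) ∈ dyadic k.1 m) ×ˢ
        ((translations k.2).filter fun m => (x.2 : ℝ) ∈ dyadic k.2 m) := fun m hm => by
      simp only [hA, translations₂, cell, Finset.mem_filter, Finset.mem_product, Set.mem_prod,
        Set.mem_preimage] at hm ⊢
      tauto
    refine (Finset.card_le_card this).trans ?_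
    rw [Finset.card_product]
    exact Nat.mul_le_mul (card_filter_dyadic_le _ _) (card_filter_dyadic_le _ _)
  rcases A.eq_empty_or_nonempty with h | h
  · rw [hS, h]
    simpa using Finset.sum_nonneg hnn
  · obtain ⟨m, hm, hmax⟩ := A.exists_max_image (fun m => |c k m|) h
    have h1 : |levelStep c k x| ≤ 4 * |c k m| := by
      rw [hS]
      refine (Finset.abs_sum_le_sum_abs _ _).trans ((Finset.sum_le_card_nsmul _ _ _ hmax).trans ?_)
      rw [nsmul_eq_mul]
      gcongr
      exact_mod_cast hcard
    have h2 : (levelStep c k x) ^ 2 / 256 ≤ (c k m) ^ 2 / 16 := by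
      have := pow_le_pow_left₀ (abs_nonneg _) h1 2
      rw [mul_pow, sq_abs, sq_abs] at this
      linarith
    have hm' := Finset.mem_filter.1 hm
    calc Real.exp ((levelStep c k x) ^ 2 / 256) - 1 ≤ Real.exp ((c k m) ^ 2 / 16) := by
          linarith [Real.exp_le_exp.2 h2]
      _ = (cell k m).indicator (fun _ => Real.exp ((c k m) ^ 2 / 16)) x := by
          rw [Set.indicator_of_mem hm'.2]
      _ ≤ _ := Finset.single_le_sum hnn hm'.1

/-- Bernoulli's inequality for exp(y/M) raised to the power M. -/
lemma exp_div_sub_one_le {M y : ℝ} (hM : 1 ≤ M) (hy : 0 ≤ y) :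
    Real.exp (y / M) - 1 ≤ M⁻¹ * (Real.exp y - 1) := by
  have hM0 : 0 < M := by linarith
  have h1 : 0 ≤ Real.exp (y / M) - 1 := by
    linarith [Real.one_le_exp (show 0 ≤ y / M by positivity)]
  have h := one_add_mul_self_le_rpow_one_add (by linarith : -1 ≤ Real.exp (y / M) - 1) hM
  rw [add_sub_cancel, ← Real.exp_mul, div_mul_cancel₀ _ hM0.ne'] at h
  rw [le_inv_mul_iff₀ hM0]
  linarith

/-- The admissible radius is 16√M: the 16 matches the 256 of `exp_levelStep_le`, and √M brings an
integral bounded by M down to 1 by `exp_div_sub_one_le`. -/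
theorem orliczSeqNorm_lt_top {c : ℤ × ℤ → ℕ × ℕ → ℝ} {M : ℝ} (hM : 1 ≤ M)
    (hc : ∀ k ∈ levels, expMean c k ≤ M) : orliczSeqNorm c < ∞ := by
  have hM0 : 0 < M := by linarith
  refine lt_of_le_of_lt (b := ENNReal.ofReal (16 * Real.sqrt M)) ?_ ENNReal.ofReal_lt_top
  refine iSup₂_le fun k hk => ?_
  unfold orliczNorm
  refine iInf_le_of_le _ (iInf_le_of_le (by positivity) (iInf_le _ ?_))
  have hpt : ∀ x, ENNReal.ofReal (Φ₂ (|levelStep c k x| / (16 * Real.sqrt M))) ≤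
      ENNReal.ofReal M⁻¹ * ∑ m ∈ translations₂ k, (cell k m).indicator
        (fun _ => ENNReal.ofReal (Real.exp ((c k m) ^ 2 / 16))) x := by
    intro x
    have h1 : Φ₂ (|levelStep c k x| / (16 * Real.sqrt M)) ≤
        M⁻¹ * ∑ m ∈ translations₂ k,
          (cell k m).indicator (fun _ => Real.exp ((c k m) ^ 2 / 16)) x := by
      unfold Φ₂
      rw [div_pow, sq_abs, mul_pow, Real.sq_sqrt hM0.le,
        show (levelStep c k x) ^ 2 / (16 ^ 2 * M) = (levelStep c k x) ^ 2 / 256 / M by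
          rw [div_div]; norm_num]
      refine (exp_div_sub_one_le hM (by positivity)).trans ?_
      gcongr
      exact exp_levelStep_le c k x
    refine (ENNReal.ofReal_le_ofReal h1).trans (le_of_eq ?_)
    rw [ENNReal.ofReal_mul (by positivity), ENNReal.ofReal_sum_of_nonneg fun m _ =>
      Set.indicator_nonneg (fun _ _ => (Real.exp_pos _).le) _]
    congr 1
    refine Finset.sum_congr rfl fun m _ => ?_
    by_cases h : x ∈ cell k m <;> simp [h]
  calc _ ≤ ∫⁻ x, ENNReal.ofReal M⁻¹ * ∑ m ∈ translations₂ k, (cell k m).indicator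
        (fun _ => ENNReal.ofReal (Real.exp ((c k m) ^ 2 / 16))) x := lintegral_mono hpt
    _ = ENNReal.ofReal M⁻¹ * ∑ m ∈ translations₂ k,
        ENNReal.ofReal (Real.exp ((c k m) ^ 2 / 16)) * volume (cell k m) := by
      rw [lintegral_const_mul' _ _ ENNReal.ofReal_ne_top, lintegral_finsetSum _ fun m _ =>
        measurable_const.indicator (measurableSet_cell k m)]
      simp_rw [lintegral_indicator_const (measurableSet_cell k _)]
    _ ≤ ENNReal.ofReal M⁻¹ * ∑ m ∈ translations₂ k,
        ENNReal.ofReal (Real.exp ((c k m) ^ 2 / 16)) * ENNReal.ofReal (cellVol k) := by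
      gcongr with m _
      exact volume_cell_le hk m
    _ = ENNReal.ofReal (M⁻¹ * expMean c k) := by
      rw [← Finset.sum_mul, ← ENNReal.ofReal_sum_of_nonneg fun _ _ => (Real.exp_pos _).le,
        ← ENNReal.ofReal_mul (Finset.sum_nonneg fun _ _ => (Real.exp_pos _).le),
        ← ENNReal.ofReal_mul (by positivity), expMean, mul_comm (cellVol k)]
    _ ≤ 1 := by
      rw [ENNReal.ofReal_le_one, inv_mul_le_iff₀ hM0, mul_one]
      exact hc k hk

/-! ### The exponential means of the coefficients of the Brownian sheet -/

/-! ### Second differences and the kernel min -/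

lemma node_mem_Icc {j : ℤ} (hj : -1 ≤ j) {m : ℕ} (hm : m ∈ translations j) (a : Fin 3) :
    node j m a ∈ Set.Icc (0 : ℝ) 1 := by
  unfold node
  split_ifs with h
  · have : m < 2 := by simpa [translations, h] using hm
    have : (m : ℝ) ≤ 1 := by exact_mod_cast Nat.lt_succ_iff.1 this
    exact ⟨Nat.cast_nonneg _, this⟩
  · obtain ⟨n, rfl⟩ := Int.eq_ofNat_of_zero_le (show 0 ≤ j by omega)
    have hm' : m < 2 ^ n := by simpa [translations, h] using hm
    have hm2 : (m : ℝ) + 1 ≤ 2 ^ n := by exact_mod_cast hm'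
    have ha : ((a : ℕ) : ℝ) ≤ 2 := by exact_mod_cast Nat.lt_succ_iff.1 a.2
    simp only [zpow_natCast]
    refine ⟨by positivity, ?_⟩
    rw [div_le_one (by positivity)]
    linarith

lemma coe_inode {j : ℤ} (hj : -1 ≤ j) {m : ℕ} (hm : m ∈ translations j) (a : Fin 3) :
    (inode j m a : ℝ) = node j m a := by
  unfold inode
  rw [Set.projIcc_of_mem _ (node_mem_Icc hj hm a)]

/-- The covariances of the Faber coefficients of level `j` of a Brownian motion. -/
noncomputable def gram (j : ℤ) (m m' : ℕ) : ℝ :=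
  ∑ a, ∑ a', weight j a * weight j a' * min (inode j m a : ℝ) (inode j m' a')

lemma gram_comm (j : ℤ) (m m' : ℕ) : gram j m m' = gram j m' m := by
  unfold gram
  rw [Finset.sum_comm]
  refine Finset.sum_congr rfl fun a _ => Finset.sum_congr rfl fun b _ => ?_
  rw [min_comm]
  ring

/-- For j ≥ 0 every node of m lies to the left of every node of m', so the kernel depends on the
first argument only and the weights, which sum to zero, annihilate it. For j = -1 the entry is
min(0,1) = 0. -/
lemma gram_eq_zero_of_lt {j : ℤ} (hj : -1 ≤ j) {m m' : ℕ} (hm : m ∈ translations j)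
    (hm' : m' ∈ translations j) (h : m < m') : gram j m m' = 0 := by
  unfold gram
  simp_rw [coe_inode hj hm, coe_inode hj hm']
  have h1 : (m : ℝ) + 1 ≤ m' := by exact_mod_cast h
  by_cases hj' : j = -1
  · have hm2 : m' < 2 := by simpa [translations, hj'] using hm'
    have hm0 : m = 0 := by omega
    have hm1 : m' = 1 := by omega
    simp [node, weight, hj', hm0, hm1]
  · have hN : (0 : ℝ) < 2 ^ j := by positivity
    have hmin : ∀ a a' : Fin 3, min (node j m a) (node j m' a') = node j m a := fun a a' => by
      have ha : ((a : ℕ) : ℝ) ≤ 2 := by exact_mod_cast Nat.lt_succ_iff.1 a.2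
      have ha' : (0 : ℝ) ≤ (a' : ℕ) := Nat.cast_nonneg _
      apply min_eq_left
      unfold node
      rw [if_neg hj', if_neg hj']
      gcongr ?_ / _
      linarith
    simp_rw [hmin]
    simp only [weight, hj', if_false, Fin.sum_univ_three, Matrix.cons_val]
    ring

lemma gram_eq_zero {j : ℤ} (hj : -1 ≤ j) {m m' : ℕ} (hm : m ∈ translations j)
    (hm' : m' ∈ translations j) (h : m ≠ m') : gram j m m' = 0 := by
  rcases lt_or_gt_of_ne h with h | h
  · exact gram_eq_zero_of_lt hj hm hm' h
  · rw [gram_comm]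
    exact gram_eq_zero_of_lt hj hm' hm h

/-- The midpoint second difference of Brownian motion has variance 2^{-j}/4; at level -1 the scaled
values are 0 and 1/2. -/
lemma gram_self {j : ℤ} (hj : -1 ≤ j) {m : ℕ} (hm : m ∈ translations j) :
    0 ≤ (2 : ℝ) ^ j * gram j m m ∧ (2 : ℝ) ^ j * gram j m m ≤ 1 := by
  unfold gram
  simp_rw [coe_inode hj hm]
  by_cases hj' : j = -1
  · have hm2 : m < 2 := by simpa [translations, hj'] using hm
    simp only [node, weight, hj', if_true, Fin.sum_univ_three, Matrix.cons_val]
    interval_cases m <;> norm_num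
  · have hN : (0 : ℝ) < 2 ^ j := by positivity
    have h01 : node j m 0 ≤ node j m 1 := by
      simp only [node, hj', if_false]; gcongr; simp
    have h12 : node j m 1 ≤ node j m 2 := by
      simp only [node, hj', if_false]; gcongr; simp
    have h02 := h01.trans h12
    have hd : (2 : ℝ) ^ j * (node j m 2 - node j m 0) = 1 := by
      simp only [node, hj', if_false, Fin.val_zero, Fin.val_two]
      push_cast
      field_simp
      ring
    simp only [weight, hj', if_false, Fin.sum_univ_three, Matrix.cons_val, min_self,
      min_eq_left h01, min_eq_left h12, min_eq_left h02, min_eq_right h01, min_eq_right h12,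
      min_eq_right h02]
    constructor <;> linarith

lemma summable_indicator_cellVol : Summable (levels.indicator cellVol) := by
  have h1 : Summable fun j : ℤ => (Set.Ici (-1 : ℤ)).indicator (fun j => (1 / 2 : ℝ) ^ j.toNat) j := by
    refine Summable.of_nat_of_neg ?_ (summable_of_ne_finset_zero (s := Finset.range 2) ?_)
    · refine (summable_geometric_of_lt_one (by norm_num) (by norm_num : (1 / 2 : ℝ) < 1)).congr ?_
      intro n
      rw [Set.indicator_of_mem (by simp)]
      simp
    · intro n hn
      rw [Set.indicator_of_notMem]
      simp only [Finset.mem_range, Set.mem_Ici] at hn ⊢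
      omega
  have h0 : ∀ j, 0 ≤ (Set.Ici (-1 : ℤ)).indicator (fun j => (1 / 2 : ℝ) ^ j.toNat) j := fun j =>
    Set.indicator_nonneg (fun _ _ => by positivity) j
  refine (h1.mul_of_nonneg h1 h0 h0).congr fun k => ?_
  by_cases ha : -1 ≤ k.1 <;> by_cases hb : -1 ≤ k.2 <;> simp [levels, cellVol, ha, hb]

/-! ### The law of the Faber coefficients -/

section Gaussian

variable {Ω : Type*} [MeasurableSpace Ω] {P : Measure Ω} {B : I × I → Ω → ℝ}

lemma IsBrownianSheet.isGaussianProcess_faberCoeff (hB : IsBrownianSheet B P) (k : ℤ × ℤ) :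
    IsGaussianProcess (fun m ω => faberCoeff (fun t => B t ω) k m) P := by
  classical
  refine hB.gaussian.of_isGaussianProcess fun m => ⟨Finset.univ.image
    (fun p : Fin 3 × Fin 3 => (inode k.1 m.1 p.1, inode k.2 m.2 p.2)),
    ∑ a, ∑ b, ((2 : ℝ) ^ (((k.1 + k.2 : ℤ) : ℝ) / 2) * (weight k.1 a * weight k.2 b)) •
      ContinuousLinearMap.proj ⟨(inode k.1 m.1 a, inode k.2 m.2 b),
        Finset.mem_image.2 ⟨(a, b), Finset.mem_univ _, rfl⟩⟩, fun ω => ?_⟩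
  simp [faberCoeff, mixedDiff, Finset.mul_sum, mul_assoc]

/-- Both the functionals and the covariance kernel are tensor products, so bilinearity splits the
covariance into one factor per variable. -/
lemma IsBrownianSheet.covariance_faberCoeff [IsProbabilityMeasure P] (hB : IsBrownianSheet B P) (k : ℤ × ℤ)
    (m m' : ℕ × ℕ) :
    cov[fun ω => faberCoeff (fun t => B t ω) k m, fun ω => faberCoeff (fun t => B t ω) k m'; P] =
      ((2 : ℝ) ^ k.1 * gram k.1 m.1 m'.1) * ((2 : ℝ) ^ k.2 * gram k.2 m.2 m'.2) := by
  have hL : ∀ t, MemLp (B t) 2 P := fun t =>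
    (hB.gaussian.hasGaussianLaw_eval t).memLp (by simp)
  have e : (2 : ℝ) ^ (((k.1 + k.2 : ℤ) : ℝ) / 2) * (2 : ℝ) ^ (((k.1 + k.2 : ℤ) : ℝ) / 2) =
      (2 : ℝ) ^ k.1 * (2 : ℝ) ^ k.2 := by
    rw [← Real.rpow_add two_pos, add_halves, Real.rpow_intCast, zpow_add₀ two_ne_zero]
  have hmd : cov[fun ω => mixedDiff (fun t => B t ω) k m,
      fun ω => mixedDiff (fun t => B t ω) k m'; P] = gram k.1 m.1 m'.1 * gram k.2 m.2 m'.2 := by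
    unfold mixedDiff gram
    rw [covariance_fun_sum_fun_sum]
    · simp_rw [Finset.sum_mul_sum]
      refine Finset.sum_congr rfl fun a _ => ?_
      rw [Finset.sum_comm]
      refine Finset.sum_congr rfl fun a' _ => ?_
      rw [covariance_fun_sum_fun_sum (fun _ => (hL _).const_mul _) fun _ => (hL _).const_mul _]
      refine Finset.sum_congr rfl fun b _ => Finset.sum_congr rfl fun b' _ => ?_
      rw [covariance_const_mul_left, covariance_const_mul_right, hB.covariance]
      ring
    all_goals
      intro a
      exact memLp_finsetSum _ fun b _ => (hL _).const_mul _
  unfold faberCoeff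
  rw [covariance_const_mul_left, covariance_const_mul_right, hmd, ← mul_assoc, e]
  ring

lemma IsBrownianSheet.integral_faberCoeff (hB : IsBrownianSheet B P) (k : ℤ × ℤ) (m : ℕ × ℕ) :
    ∫ ω, faberCoeff (fun t => B t ω) k m ∂P = 0 := by
  have hi : ∀ t, Integrable (B t) P := fun t =>
    (hB.gaussian.hasGaussianLaw_eval t).integrable
  unfold faberCoeff mixedDiff
  rw [integral_const_mul, integral_finsetSum _ fun a _ =>
    integrable_finsetSum _ fun b _ => (hi _).const_mul _]
  simp_rw [integral_finsetSum _ fun b _ => (hi _).const_mul _, integral_const_mul, hB.mean_zero]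
  simp

/-! ### Square exponential moments of Gaussian variables -/

lemma lintegral_exp_sq_gaussianReal_zero_one_le :
    ∫⁻ x, ENNReal.ofReal (Real.exp (x ^ 2 / 8)) ∂(gaussianReal 0 1) ≤ 2 := by
  rw [gaussianReal_of_var_ne_zero _ one_ne_zero, lintegral_withDensity_eq_lintegral_mul _
    (measurable_gaussianPDF 0 1) (by fun_prop)]
  have h1 : ∀ x : ℝ, (gaussianPDF 0 1 * fun x => ENNReal.ofReal (Real.exp (x ^ 2 / 8))) x =
      ENNReal.ofReal ((Real.sqrt (2 * Real.pi))⁻¹ * Real.exp (-(3 / 8) * x ^ 2)) := fun x => by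
    simp only [Pi.mul_apply, gaussianPDF, gaussianPDFReal]
    rw [← ENNReal.ofReal_mul (by positivity), mul_assoc, ← Real.exp_add]
    simp only [NNReal.coe_one, mul_one, sub_zero]
    ring_nf
  simp_rw [h1]
  rw [← ofReal_integral_eq_lintegral_ofReal
    ((integrable_exp_neg_mul_sq (by norm_num)).const_mul _)
    (ae_of_all _ fun x => by positivity), integral_const_mul, integral_gaussian]
  -- The left side is √(4/3).
  have h2 : (Real.sqrt (2 * Real.pi))⁻¹ * Real.sqrt (Real.pi / (3 / 8)) ≤ 2 := by
    rw [inv_mul_le_iff₀ (by positivity), ← Real.sqrt_sq (zero_le_two (α := ℝ)),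
      ← Real.sqrt_mul (by positivity)]
    apply Real.sqrt_le_sqrt
    rw [Real.sqrt_sq zero_le_two]
    linarith [Real.pi_pos]
  simpa using ENNReal.ofReal_le_ofReal h2

/-- Scaling a standard Gaussian by √v ≤ 1 only decreases the integrand; this form includes the
degenerate case v = 0. -/
lemma lintegral_exp_sq_gaussianReal_le {v : NNReal} (hv : v ≤ 1) :
    ∫⁻ x, ENNReal.ofReal (Real.exp (x ^ 2 / 8)) ∂(gaussianReal 0 v) ≤ 2 := by
  have h : gaussianReal 0 v = (gaussianReal 0 1).map (fun x => Real.sqrt v * x) := by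
    rw [gaussianReal_map_const_mul, mul_zero, mul_one]
    congr 1
    ext
    simp
  rw [h, lintegral_map (by fun_prop) (by fun_prop)]
  refine (lintegral_mono fun x => ?_).trans lintegral_exp_sq_gaussianReal_zero_one_le
  apply ENNReal.ofReal_le_ofReal
  rw [Real.exp_le_exp, mul_pow, Real.sq_sqrt v.coe_nonneg]
  have : (v : ℝ) ≤ 1 := by exact_mod_cast hv
  have := mul_le_of_le_one_left (sq_nonneg x) this
  linarith

lemma integral_exp_sq_le {X : Ω → ℝ} (hX : HasGaussianLaw X P) (h0 : ∫ ω, X ω ∂P = 0)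
    (h1 : Var[X; P] ≤ 1) : Integrable (fun ω => Real.exp (X ω ^ 2 / 8)) P ∧
      ∫ ω, Real.exp (X ω ^ 2 / 8) ∂P ≤ 2 := by
  have hm : AEMeasurable X P := hX.aemeasurable
  have hl : ∫⁻ ω, ENNReal.ofReal (Real.exp (X ω ^ 2 / 8)) ∂P ≤ 2 := by
    have := lintegral_exp_sq_gaussianReal_le (v := Var[X; P].toNNReal)
      (by simpa using Real.toNNReal_le_toNNReal h1)
    rw [← h0, ← hX.map_eq_gaussianReal, lintegral_map' (by fun_prop) hm] at this
    exact this
  have hsm : AEStronglyMeasurable (fun ω => Real.exp (X ω ^ 2 / 8)) P :=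
    (by fun_prop : AEMeasurable (fun ω => Real.exp (X ω ^ 2 / 8)) P).aestronglyMeasurable
  refine ⟨(lintegral_ofReal_ne_top_iff_integrable hsm
    (ae_of_all _ fun ω => (Real.exp_pos _).le)).1 (ne_top_of_le_ne_top (by simp) hl), ?_⟩
  rw [integral_eq_lintegral_of_nonneg_ae (ae_of_all _ fun ω => (Real.exp_pos _).le) hsm]
  exact ENNReal.toReal_le_of_le_ofReal zero_le_two (by simpa using hl)

variable [IsProbabilityMeasure P]

/-- Chebyshev's inequality for the exponential means of the coefficients of level `k`. -/
lemma IsBrownianSheet.measure_expMean_ge_le (hB : IsBrownianSheet B P) {k : ℤ × ℤ}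
    (hk : k ∈ levels) :
    P {ω | 9 ≤ expMean (faberCoeff fun t => B t ω) k} ≤ ENNReal.ofReal (8 * cellVol k) := by
  set X : ℕ × ℕ → Ω → ℝ := fun m ω => faberCoeff (fun t => B t ω) k m with hX
  have hG : IsGaussianProcess X P := hB.isGaussianProcess_faberCoeff k
  have hvar : ∀ m ∈ translations₂ k, Var[X m; P] ≤ 1 := fun m hm => by
    have hm' := Finset.mem_product.1 hm
    rw [← covariance_self (hG.aemeasurable m), hB.covariance_faberCoeff]
    have g1 := gram_self hk.1 hm'.1
    have g2 := gram_self hk.2 hm'.2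
    exact mul_le_one₀ g1.2 g2.1 g2.2
  -- The coefficients are jointly Gaussian, so uncorrelated means independent; pairwise independence
  -- is all that the variance of the sum needs.
  have hind : ∀ m ∈ translations₂ k, ∀ m' ∈ translations₂ k, m ≠ m' → X m ⟂ᵢ[P] X m' := by
    intro m hm m' hm' hne
    have h1 := Finset.mem_product.1 hm
    have h2 := Finset.mem_product.1 hm'
    refine hG.hasGaussianLaw_prodMk.indepFun_of_covariance_eq_zero ?_
    rw [hB.covariance_faberCoeff]
    by_cases h : m.1 = m'.1
    · rw [gram_eq_zero hk.2 h1.2 h2.2 fun h' => hne (Prod.ext h h')]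
      simp
    · rw [gram_eq_zero hk.1 h1.1 h2.1 h]
      simp
  have hexp := fun m (hm : m ∈ translations₂ k) =>
    integral_exp_sq_le (hG.hasGaussianLaw_eval m) (hB.integral_faberCoeff k m) (hvar m hm)
  -- The exponent 1/16 is chosen so that Y² = exp(X²/8) is still integrable.
  set Y : ℕ × ℕ → Ω → ℝ := fun m ω => Real.exp (X m ω ^ 2 / 16) with hY
  have hYm : ∀ m, AEStronglyMeasurable (Y m) P := fun m => by
    have := hG.aemeasurable m
    exact (by fun_prop : AEMeasurable (Y m) P).aestronglyMeasurable
  have hYsq : ∀ m ω, Y m ω ^ 2 = Real.exp (X m ω ^ 2 / 8) := fun m ω => by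
    simp only [hY]
    rw [← Real.exp_nat_mul]
    congr 1
    push_cast
    ring
  have hYL : ∀ m ∈ translations₂ k, MemLp (Y m) 2 P := fun m hm => by
    rw [memLp_two_iff_integrable_sq (hYm m)]
    simp_rw [hYsq]
    exact (hexp m hm).1
  have hYvar : ∀ m ∈ translations₂ k, Var[Y m; P] ≤ 2 := fun m hm => by
    refine (variance_le_expectation_sq (hYm m)).trans ?_
    simp_rw [Pi.pow_apply, hYsq]
    exact (hexp m hm).2
  have hYint : ∀ m ∈ translations₂ k, ∫ ω, Y m ω ∂P ≤ 2 := fun m hm => by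
    refine le_trans (integral_mono ((hYL m hm).integrable (by norm_num)) (hexp m hm).1 ?_)
      (hexp m hm).2
    intro ω
    simp only [hY]
    rw [Real.exp_le_exp]
    linarith [sq_nonneg (X m ω)]
  have hV := cellVol_pos k
  have hN := cellVol_mul_card_le k
  set Z : Ω → ℝ := fun ω => cellVol k * (∑ m ∈ translations₂ k, Y m) ω with hZ
  have hZe : ∀ ω, expMean (faberCoeff fun t => B t ω) k = Z ω := fun ω => by
    simp [expMean, hZ, hY, hX]
  have hZL : MemLp Z 2 P := (memLp_finsetSum' _ hYL).const_mul _
  have hZint : ∫ ω, Z ω ∂P ≤ 8 := by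
    simp only [hZ, Finset.sum_apply]
    rw [integral_const_mul, integral_finsetSum _ fun m hm => (hYL m hm).integrable (by norm_num)]
    calc _ ≤ cellVol k * ((translations₂ k).card * 2) := by
          gcongr
          simpa using Finset.sum_le_card_nsmul _ _ _ hYint
      _ ≤ 8 := by linarith
  -- The variance carries the square of the cell area but only about one over the area many terms,
  -- so one factor of the area survives.
  have hZvar : Var[Z; P] ≤ 8 * cellVol k := by
    simp only [hZ]
    rw [variance_const_mul, IndepFun.variance_sum hYL]
    · calc _ ≤ cellVol k ^ 2 * ((translations₂ k).card * 2) := by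
            gcongr
            simpa using Finset.sum_le_card_nsmul _ _ _ hYvar
        _ = (cellVol k * (translations₂ k).card) * (2 * cellVol k) := by ring
        _ ≤ 4 * (2 * cellVol k) := by gcongr
        _ = _ := by ring
    · intro m hm m' hm' hne
      exact (hind m hm m' hm' hne).comp (φ := fun x => Real.exp (x ^ 2 / 16))
        (ψ := fun x => Real.exp (x ^ 2 / 16)) (by fun_prop) (by fun_prop)
  -- Since E Z ≤ 8, the event Z ≥ 9 forces a deviation of at least 1 from the mean.
  simp_rw [hZe]
  calc P {ω | 9 ≤ Z ω} ≤ P {ω | 1 ≤ |Z ω - ∫ x, Z x ∂P|} := by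
        refine measure_mono fun ω hω => ?_
        simp only [Set.mem_ofPred_eq] at hω ⊢
        exact le_trans (by linarith) (le_abs_self _)
    _ ≤ ENNReal.ofReal (Var[Z; P] / 1 ^ 2) := meas_ge_le_variance_div_sq hZL one_pos
    _ ≤ _ := ENNReal.ofReal_le_ofReal (by simpa using hZvar)

/-- Almost surely, the exponential means of the coefficients of a Brownian sheet are bounded. -/
theorem IsBrownianSheet.exists_expMean_le (hB : IsBrownianSheet B P) :
    ∀ᵐ ω ∂P, ∃ M : ℝ, 1 ≤ M ∧ ∀ k ∈ levels, expMean (faberCoeff fun t => B t ω) k ≤ M := by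
  have hsum : ∑' k : ℤ × ℤ,
      P {ω | k ∈ levels ∧ 9 ≤ expMean (faberCoeff fun t => B t ω) k} ≠ ∞ := by
    refine ne_top_of_le_ne_top (summable_indicator_cellVol.mul_left 8).tsum_ofReal_ne_top
      (ENNReal.tsum_le_tsum fun k => ?_)
    by_cases hk : k ∈ levels
    · simpa [hk] using hB.measure_expMean_ge_le hk
    · simp [hk]
  -- Borel–Cantelli: only finitely many levels exceed 9, and their means are added to the bound.
  filter_upwards [ae_finite_setOfPred_mem hsum] with ω hω
  have hnn : ∀ k, 0 ≤ expMean (faberCoeff fun t => B t ω) k := fun k =>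
    mul_nonneg (cellVol_pos k).le (Finset.sum_nonneg fun _ _ => (Real.exp_pos _).le)
  refine ⟨9 + ∑ k ∈ hω.toFinset, expMean (faberCoeff fun t => B t ω) k, ?_, fun k hk => ?_⟩
  · linarith [Finset.sum_nonneg fun k (_ : k ∈ hω.toFinset) => hnn k]
  · by_cases h : 9 ≤ expMean (faberCoeff fun t => B t ω) k
    · have : k ∈ hω.toFinset := by simpa using ⟨hk, h⟩
      linarith [Finset.single_le_sum (fun k _ => hnn k) this]
    · linarith [Finset.sum_nonneg fun k (_ : k ∈ hω.toFinset) => hnn k]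

end Gaussian

/-! ### Tensor product expansions over the plane -/

/-- Minkowski's inequality for a pointwise convergent series. -/
lemma eLpNorm_tsum_le {ι α : Type*} [Countable ι] [MeasurableSpace α] {μ : Measure α}
    {f : ι → α → ℝ} {p : ℝ≥0∞} (hp : 1 ≤ p) (hf : ∀ i, AEStronglyMeasurable (f i) μ)
    (hs : ∀ x, Summable fun i => f i x) :
    eLpNorm (fun x => ∑' i, f i x) p μ ≤ ∑' i, eLpNorm (f i) p μ := by
  -- Fatou's lemma along a sequence of finite sets exhausting the index set, with Minkowski for the
  -- finite sums.
  obtain ⟨u, hu⟩ := (atTop : Filter (Finset ι)).exists_seq_tendsto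
  refine (Lp.eLpNorm_lim_le_liminf_eLpNorm (f := fun n => ∑ i ∈ u n, f i)
    (fun n => Finset.aestronglyMeasurable_sum _ fun i _ => hf i) _
    (ae_of_all _ fun x => ?_)).trans ?_
  · simp only [Finset.sum_apply]
    exact (hs x).hasSum.comp hu
  · refine le_trans (liminf_le_liminf (v := fun _ => ∑' i, eLpNorm (f i) p μ)
      (Eventually.of_forall fun n => ?_)) (liminf_const _).le
    exact (eLpNorm_sum_le (fun i _ => hf i) hp).trans (ENNReal.sum_le_tsum _)

/-- Families of functions of one variable, indexed by levels and translations, which satisfy the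
bounds of Schur's test with the factors `θ j` relative to hat functions of level `j`. -/
structure SchurFamily (U : ℤ → ℕ → ℝ → ℝ) (θ : ℤ → ℝ) : Prop where
  measurable : ∀ j m, Measurable (U j m)
  sum_le : ∀ j x, ∑ m ∈ translations j, |U j m x| ≤ 4 * θ j
  lintegral_le : ∀ j m, ∫⁻ x, ‖U j m x‖ₑ ≤ ENNReal.ofReal ((2 : ℝ) ^ (-j) * (4 * θ j))
  eq_zero : ∀ j < -1, ∀ m x, U j m x = 0
  bdd : ∃ C, ∀ j, θ j ≤ C

/-- The part of level `k` of the expansion with coefficients `c` in the tensor products of the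
families `U` and `W`. -/
noncomputable def levelSum (c : ℤ × ℤ → ℕ × ℕ → ℝ) (U W : ℤ → ℕ → ℝ → ℝ) (k : ℤ × ℤ) (x : ℝ × ℝ) :
    ℝ :=
  ∑ m ∈ translations₂ k,
    c k m * (2 : ℝ) ^ (-((k.1 + k.2 : ℤ) : ℝ) * (1 / 2)) * (U k.1 m.1 x.1 * W k.2 m.2 x.2)

/-- The expansion with coefficients `c` in the tensor products of the families `U` and `W`. -/
noncomputable def synthesis (c : ℤ × ℤ → ℕ × ℕ → ℝ) (U W : ℤ → ℕ → ℝ → ℝ) (x : ℝ × ℝ) : ℝ :=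
  ∑' k, levelSum c U W k x

namespace SchurFamily

variable {U W : ℤ → ℕ → ℝ → ℝ} {θ η : ℤ → ℝ} {c : ℤ × ℤ → ℕ × ℕ → ℝ}

lemma nonneg (hU : SchurFamily U θ) (j : ℤ) : 0 ≤ θ j := by
  have := (Finset.sum_nonneg fun m _ => abs_nonneg (U j m 0)).trans (hU.sum_le j 0)
  linarith

/-- Both bounds are translation invariant, so a difference costs a factor 2, uniformly in h. -/
lemma fwdDiff (hU : SchurFamily U θ) (h : ℝ) :
    SchurFamily (fun j m => _root_.fwdDiff h (U j m)) (fun j => 2 * θ j) where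
  measurable j m := by
    have := hU.measurable j m
    unfold _root_.fwdDiff
    fun_prop
  sum_le j x := by
    calc _ ≤ ∑ m ∈ translations j, (|U j m (x + h)| + |U j m x|) :=
          Finset.sum_le_sum fun m _ => abs_sub _ _
      _ ≤ _ := by
          rw [Finset.sum_add_distrib]
          linarith [hU.sum_le j (x + h), hU.sum_le j x]
  lintegral_le j m := by
    have hm := hU.measurable j m
    calc _ ≤ ∫⁻ x, (‖U j m (x + h)‖ₑ + ‖U j m x‖ₑ) := lintegral_mono fun x => enorm_sub_le
      _ = (∫⁻ x, ‖U j m x‖ₑ) + ∫⁻ x, ‖U j m x‖ₑ := by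
          rw [lintegral_add_right _ (by fun_prop),
            lintegral_add_right_eq_self (fun x => ‖U j m x‖ₑ) h]
      _ ≤ ENNReal.ofReal ((2 : ℝ) ^ (-j) * (4 * θ j)) +
          ENNReal.ofReal ((2 : ℝ) ^ (-j) * (4 * θ j)) :=
          add_le_add (hU.lintegral_le j m) (hU.lintegral_le j m)
      _ = _ := by
          have := hU.nonneg j
          rw [← ENNReal.ofReal_add (by positivity) (by positivity)]
          congr 1
          ring
  eq_zero j hj m x := by simp [_root_.fwdDiff, hU.eq_zero j hj]
  bdd := by
    obtain ⟨C, hC⟩ := hU.bdd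
    exact ⟨2 * C, fun j => by linarith [hC j]⟩

lemma measurable_levelSum (hU : SchurFamily U θ) (hW : SchurFamily W η) (k : ℤ × ℤ) :
    Measurable (levelSum c U W k) := by
  unfold levelSum
  refine Finset.measurable_sum _ fun m _ => ?_
  have h1 := hU.measurable k.1 m.1
  have h2 := hW.measurable k.2 m.2
  fun_prop

lemma levelSum_eq_zero (hU : SchurFamily U θ) (hW : SchurFamily W η) {k : ℤ × ℤ} (hk : k ∉ levels)
    (x : ℝ × ℝ) : levelSum c U W k x = 0 := by
  refine Finset.sum_eq_zero fun m _ => ?_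
  by_cases h : k.1 < -1
  · simp [hU.eq_zero _ h]
  · have : k.2 < -1 := by
      by_contra h'
      exact hk ⟨not_lt.1 h, not_lt.1 h'⟩
    simp [hW.eq_zero _ this]

lemma sum_enorm_le (hU : SchurFamily U θ) (j : ℤ) (x : ℝ) :
    ∑ m ∈ translations j, ‖U j m x‖ₑ ≤ ENNReal.ofReal (4 * θ j) := by
  simp_rw [Real.enorm_eq_ofReal_abs]
  rw [← ENNReal.ofReal_sum_of_nonneg fun _ _ => abs_nonneg _]
  exact ENNReal.ofReal_le_ofReal (hU.sum_le j x)

/-- Schur's test for the part of level `k` of an expansion. -/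
lemma eLpNorm_levelSum_le (hU : SchurFamily U θ) (hW : SchurFamily W η) {p : ℝ≥0∞} (hp : 1 ≤ p)
    (hp' : p ≠ ∞) {k : ℤ × ℤ} {A : ℝ} (hA : 0 ≤ A)
    (hc : (2 : ℝ) ^ (-(k.1 + k.2)) * ∑ m ∈ translations₂ k, |c k m| ^ p.toReal ≤ A ^ p.toReal) :
    eLpNorm (levelSum c U W k) p volume ≤
      ENNReal.ofReal ((2 : ℝ) ^ (-((k.1 + k.2 : ℤ) : ℝ) * (1 / 2))) *
        (ENNReal.ofReal (4 * θ k.1) * ENNReal.ofReal (4 * η k.2)) * ENNReal.ofReal A := by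
  set q := p.toReal with hq
  have hq1 : 1 ≤ q := by
    rw [hq, ← ENNReal.toReal_one]
    exact ENNReal.toReal_mono hp' hp
  have hq0 : 0 < q := by linarith
  set s : ℝ≥0∞ := ENNReal.ofReal ((2 : ℝ) ^ (-((k.1 + k.2 : ℤ) : ℝ) * (1 / 2))) with hs
  set D : ℝ≥0∞ := ENNReal.ofReal (4 * θ k.1) * ENNReal.ofReal (4 * η k.2) with hD
  set w : ℕ × ℕ → ℝ × ℝ → ℝ≥0∞ := fun m x => ‖U k.1 m.1 x.1‖ₑ * ‖W k.2 m.2 x.2‖ₑ with hw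
  have hwm : ∀ m, Measurable (w m) := fun m => by
    have h1 := hU.measurable k.1 m.1
    have h2 := hW.measurable k.2 m.2
    simp only [hw]
    fun_prop
  have hwsum : ∀ x, ∑ m ∈ translations₂ k, w m x ≤ D := fun x => by
    simp only [hw, translations₂]
    rw [Finset.sum_product]
    dsimp only
    rw [← Finset.sum_mul_sum]
    exact mul_le_mul' (hU.sum_enorm_le _ _) (hW.sum_enorm_le _ _)
  have hwint : ∀ m, ∫⁻ x, w m x ≤ D * ENNReal.ofReal ((2 : ℝ) ^ (-(k.1 + k.2))) := fun m => by
    simp only [hw]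
    have h1 := hU.measurable k.1 m.1
    have h2 := hW.measurable k.2 m.2
    rw [Measure.volume_eq_prod, lintegral_prod_mul (f := fun x => ‖U k.1 m.1 x‖ₑ)
      (g := fun x => ‖W k.2 m.2 x‖ₑ) (by fun_prop) (by fun_prop)]
    refine (mul_le_mul' (hU.lintegral_le _ _) (hW.lintegral_le _ _)).trans (le_of_eq ?_)
    rw [ENNReal.ofReal_mul (q := 4 * θ k.1) (by positivity),
      ENNReal.ofReal_mul (q := 4 * η k.2) (by positivity), neg_add,
      zpow_add₀ two_ne_zero,
      ENNReal.ofReal_mul (p := (2 : ℝ) ^ (-k.1)) (q := (2 : ℝ) ^ (-k.2)) (by positivity), hD]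
    ring
  -- Hölder with respect to the weights w: the total weight, at most D, enters to the power q - 1;
  -- the remaining D comes from integrating w.
  have hpt : ∀ x, ‖levelSum c U W k x‖ₑ ^ q ≤
      s ^ q * (D ^ (q - 1) * ∑ m ∈ translations₂ k, w m x * ‖c k m‖ₑ ^ q) := fun x => by
    have h1 : ‖levelSum c U W k x‖ₑ ≤ s * ∑ m ∈ translations₂ k, w m x * ‖c k m‖ₑ := by
      refine (enorm_sum_le _ _).trans (le_of_eq ?_)
      rw [Finset.mul_sum]
      refine Finset.sum_congr rfl fun m _ => ?_
      simp only [enorm_mul, hw]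
      rw [Real.enorm_of_nonneg (by positivity : (0 : ℝ) ≤ 2 ^ (_ : ℝ))]
      ring
    refine (ENNReal.rpow_le_rpow h1 hq0.le).trans ?_
    rw [ENNReal.mul_rpow_of_nonneg _ _ hq0.le]
    refine mul_le_mul_right ((ENNReal.rpow_le_rpow
      (ENNReal.inner_le_weight_mul_Lp_of_nonneg _ hq1 _ _) hq0.le).trans ?_) _
    rw [ENNReal.mul_rpow_of_nonneg _ _ hq0.le, ← ENNReal.rpow_mul, ← ENNReal.rpow_mul,
      inv_mul_cancel₀ hq0.ne', ENNReal.rpow_one, sub_mul, inv_mul_cancel₀ hq0.ne', one_mul]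
    exact mul_le_mul_left (ENNReal.rpow_le_rpow (hwsum x) (by linarith)) _
  have hcE : ENNReal.ofReal ((2 : ℝ) ^ (-(k.1 + k.2))) * ∑ m ∈ translations₂ k, ‖c k m‖ₑ ^ q ≤
      ENNReal.ofReal A ^ q := by
    rw [ENNReal.ofReal_rpow_of_nonneg hA hq0.le]
    refine le_trans (le_of_eq ?_) (ENNReal.ofReal_le_ofReal hc)
    rw [ENNReal.ofReal_mul (by positivity), ENNReal.ofReal_sum_of_nonneg fun _ _ => by positivity]
    congr 1
    refine Finset.sum_congr rfl fun m _ => ?_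
    rw [Real.enorm_eq_ofReal_abs, ENNReal.ofReal_rpow_of_nonneg (abs_nonneg _) hq0.le]
  have hDq : D ^ (q - 1) * D = D ^ q := by
    conv_lhs => rw [← ENNReal.rpow_one D, ← ENNReal.rpow_mul, one_mul,
      ← ENNReal.rpow_add_of_nonneg _ _ (by linarith) zero_le_one, sub_add_cancel]
  have hint : ∫⁻ x, ‖levelSum c U W k x‖ₑ ^ q ≤ (s * D * ENNReal.ofReal A) ^ q := by
    calc _ ≤ ∫⁻ x, s ^ q * (D ^ (q - 1) * ∑ m ∈ translations₂ k, w m x * ‖c k m‖ₑ ^ q) :=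
          lintegral_mono hpt
      _ = s ^ q * (D ^ (q - 1) * ∑ m ∈ translations₂ k, (∫⁻ x, w m x) * ‖c k m‖ₑ ^ q) := by
          rw [lintegral_const_mul _ (by fun_prop), lintegral_const_mul _ (by fun_prop),
            lintegral_finsetSum _ (fun m _ => by fun_prop)]
          congr 2
          exact Finset.sum_congr rfl fun m _ => lintegral_mul_const _ (hwm m)
      _ ≤ s ^ q * (D ^ (q - 1) * ∑ m ∈ translations₂ k,
            (D * ENNReal.ofReal ((2 : ℝ) ^ (-(k.1 + k.2)))) * ‖c k m‖ₑ ^ q) := by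
          gcongr with m _
          exact hwint m
      _ = s ^ q * (D ^ (q - 1) * D) * (ENNReal.ofReal ((2 : ℝ) ^ (-(k.1 + k.2))) *
            ∑ m ∈ translations₂ k, ‖c k m‖ₑ ^ q) := by
          rw [← Finset.mul_sum]
          ring
      _ ≤ s ^ q * D ^ q * ENNReal.ofReal A ^ q := by
          rw [hDq]
          exact mul_le_mul_right hcE _
      _ = _ := by
          rw [ENNReal.mul_rpow_of_nonneg (s * D) _ hq0.le, ENNReal.mul_rpow_of_nonneg s _ hq0.le]
  rw [eLpNorm_eq_lintegral_rpow_enorm_toReal (by positivity) hp', ← hq]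
  refine (ENNReal.rpow_le_rpow hint (by positivity)).trans (le_of_eq ?_)
  rw [← ENNReal.rpow_mul, mul_one_div_cancel hq0.ne', ENNReal.rpow_one]

end SchurFamily

/-- Coefficients which grow at most like `2^{(k₁+k₂)/4}`. -/
def QuarterGrowth (c : ℤ × ℤ → ℕ × ℕ → ℝ) : Prop :=
  ∃ A : ℝ, ∀ k ∈ levels, ∀ m ∈ translations₂ k,
    |c k m| ≤ A * (2 : ℝ) ^ (((k.1 + k.2 : ℤ) : ℝ) * (1 / 4))

lemma summable_indicator_rpow {r : ℝ} (hr : 0 < r) :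
    Summable ((Set.Ici (-1 : ℤ)).indicator fun j : ℤ => (2 : ℝ) ^ (-(j : ℝ) * r)) := by
  refine Summable.of_nat_of_neg ?_ (summable_of_ne_finset_zero (s := Finset.range 2) ?_)
  · refine (summable_geometric_of_lt_one (by positivity : (0 : ℝ) ≤ 2 ^ (-r))
      (Real.rpow_lt_one_of_one_lt_of_neg one_lt_two (neg_neg_of_pos hr))).congr ?_
    intro n
    rw [Set.indicator_of_mem (by simp), ← Real.rpow_natCast, ← Real.rpow_mul zero_le_two]
    push_cast
    ring_nf
  · intro n hn
    rw [Set.indicator_of_notMem]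
    simp only [Finset.mem_range, Set.mem_Ici] at hn ⊢
    omega

namespace SchurFamily

variable {U W : ℤ → ℕ → ℝ → ℝ} {θ η : ℤ → ℝ} {c : ℤ × ℤ → ℕ × ℕ → ℝ}

/-- Growth 2^{(k₁+k₂)/4} against the normalisation 2^{-(k₁+k₂)/2} leaves geometric decay in both
levels. -/
lemma summable_levelSum (hU : SchurFamily U θ) (hW : SchurFamily W η) (hc : QuarterGrowth c)
    (x : ℝ × ℝ) : Summable fun k => levelSum c U W k x := by
  obtain ⟨A, hA⟩ := hc
  obtain ⟨C, hC⟩ := hU.bdd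
  obtain ⟨C', hC'⟩ := hW.bdd
  have h0 : ∀ j, 0 ≤ (Set.Ici (-1 : ℤ)).indicator (fun j : ℤ => (2 : ℝ) ^ (-(j : ℝ) * (1 / 4))) j :=
    fun j => Set.indicator_nonneg (fun _ _ => by positivity) j
  have hs := summable_indicator_rpow (r := 1 / 4) (by norm_num)
  refine Summable.of_norm_bounded ((hs.mul_of_nonneg hs h0 h0).mul_left (A * ((4 * C) * (4 * C'))))
    fun k => ?_
  by_cases hk : k ∈ levels
  -- The constant A is not assumed nonnegative; its sign comes from the bound for some admissible
  -- translation.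
  · have hA0 : 0 ≤ A * (2 : ℝ) ^ (((k.1 + k.2 : ℤ) : ℝ) * (1 / 4)) := by
      obtain ⟨m, hm⟩ : (translations₂ k).Nonempty := by
        refine Finset.Nonempty.product ?_ ?_ <;> unfold translations <;> split_ifs <;> simp
      exact (abs_nonneg _).trans (hA k hk m hm)
    have e : (2 : ℝ) ^ (((k.1 + k.2 : ℤ) : ℝ) * (1 / 4)) *
        (2 : ℝ) ^ (-((k.1 + k.2 : ℤ) : ℝ) * (1 / 2)) =
        (2 : ℝ) ^ (-(k.1 : ℝ) * (1 / 4)) * (2 : ℝ) ^ (-(k.2 : ℝ) * (1 / 4)) := by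
      rw [← Real.rpow_add two_pos, ← Real.rpow_add two_pos]
      push_cast
      ring_nf
    have hk1 : k.1 ∈ Set.Ici (-1 : ℤ) := hk.1
    have hk2 : k.2 ∈ Set.Ici (-1 : ℤ) := hk.2
    rw [Set.indicator_of_mem hk1, Set.indicator_of_mem hk2, ← e, Real.norm_eq_abs]
    calc |levelSum c U W k x|
        ≤ ∑ m ∈ translations₂ k, A * (2 : ℝ) ^ (((k.1 + k.2 : ℤ) : ℝ) * (1 / 4)) *
          (2 : ℝ) ^ (-((k.1 + k.2 : ℤ) : ℝ) * (1 / 2)) *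
            (|U k.1 m.1 x.1| * |W k.2 m.2 x.2|) := by
          refine (Finset.abs_sum_le_sum_abs _ _).trans (Finset.sum_le_sum fun m hm => ?_)
          rw [abs_mul, abs_mul, abs_mul, abs_of_nonneg (by positivity : (0 : ℝ) ≤ 2 ^ (_ : ℝ))]
          have := hA k hk m hm
          gcongr
      _ = A * (2 : ℝ) ^ (((k.1 + k.2 : ℤ) : ℝ) * (1 / 4)) *
          (2 : ℝ) ^ (-((k.1 + k.2 : ℤ) : ℝ) * (1 / 2)) *
            ((∑ m ∈ translations k.1, |U k.1 m x.1|) * ∑ m ∈ translations k.2, |W k.2 m x.2|) := by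
          rw [← Finset.mul_sum, translations₂, Finset.sum_product, Finset.sum_mul_sum]
      _ ≤ A * (2 : ℝ) ^ (((k.1 + k.2 : ℤ) : ℝ) * (1 / 4)) *
          (2 : ℝ) ^ (-((k.1 + k.2 : ℤ) : ℝ) * (1 / 2)) * ((4 * C) * (4 * C')) := by
          refine mul_le_mul_of_nonneg_left (mul_le_mul ?_ ?_ ?_ ?_) (by positivity)
          · exact (hU.sum_le _ _).trans (by linarith [hC k.1])
          · exact (hW.sum_le _ _).trans (by linarith [hC' k.2])
          · exact Finset.sum_nonneg fun _ _ => abs_nonneg _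
          · linarith [hC k.1, hU.nonneg k.1]
      _ = _ := by ring
  · rw [hU.levelSum_eq_zero hW hk, norm_zero]
    by_cases h : -1 ≤ k.1
    · have : ¬ -1 ≤ k.2 := fun h' => hk ⟨h, h'⟩
      simp [this]
    · simp [h]

lemma measurable_synthesis (hU : SchurFamily U θ) (hW : SchurFamily W η) :
    Measurable (synthesis c U W) :=
  Measurable.tsum fun k => hU.measurable_levelSum hW k

/-- Minkowski over the levels. The bound from Schur's test is a product over the variables, so the
double sum factorises. -/
lemma eLpNorm_synthesis_le (hU : SchurFamily U θ) (hW : SchurFamily W η) (hc : QuarterGrowth c)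
    {p : ℝ≥0∞} (hp : 1 ≤ p) (hp' : p ≠ ∞) {A : ℝ} (hA : 0 ≤ A)
    (hcA : ∀ k ∈ levels, (2 : ℝ) ^ (-(k.1 + k.2)) * ∑ m ∈ translations₂ k, |c k m| ^ p.toReal ≤
      A ^ p.toReal) :
    eLpNorm (synthesis c U W) p volume ≤
      (∑' j : ℤ, ENNReal.ofReal ((2 : ℝ) ^ (-(j : ℝ) * (1 / 2)) * (4 * θ j))) *
      (∑' j : ℤ, ENNReal.ofReal ((2 : ℝ) ^ (-(j : ℝ) * (1 / 2)) * (4 * η j))) *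
        ENNReal.ofReal A := by
  refine (eLpNorm_tsum_le hp (fun k => (hU.measurable_levelSum hW k).aestronglyMeasurable)
    (hU.summable_levelSum hW hc)).trans ?_
  rw [← ENNReal.tsum_mul_right, ← ENNReal.tsum_mul_right]
  simp_rw [← ENNReal.tsum_mul_left, ← ENNReal.tsum_mul_right]
  rw [← ENNReal.tsum_prod]
  refine ENNReal.tsum_le_tsum fun k => ?_
  by_cases hk : k ∈ levels
  · refine (hU.eLpNorm_levelSum_le hW hp hp' hA (hcA k hk)).trans (le_of_eq ?_)
    rw [ENNReal.ofReal_mul (q := 4 * θ k.1) (by positivity),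
      ENNReal.ofReal_mul (q := 4 * η k.2) (by positivity),
      show -((k.1 + k.2 : ℤ) : ℝ) * (1 / 2) = -(k.1 : ℝ) * (1 / 2) + -(k.2 : ℝ) * (1 / 2) by
        push_cast; ring, Real.rpow_add two_pos, ENNReal.ofReal_mul (by positivity)]
    ring
  · have : levelSum c U W k = 0 := funext fun x => hU.levelSum_eq_zero hW hk x
    simp [this]

lemma fwdDiff_synthesis_left (hU : SchurFamily U θ) (hW : SchurFamily W η) (hc : QuarterGrowth c)
    (h : ℝ) : _root_.fwdDiff (h, (0 : ℝ)) (synthesis c U W) =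
      synthesis c (fun j m => _root_.fwdDiff h (U j m)) W := by
  ext x
  unfold synthesis
  rw [_root_.fwdDiff, ← (hU.summable_levelSum hW hc _).tsum_sub (hU.summable_levelSum hW hc _)]
  refine tsum_congr fun k => ?_
  unfold levelSum
  rw [← Finset.sum_sub_distrib]
  refine Finset.sum_congr rfl fun m _ => ?_
  simp only [_root_.fwdDiff, Prod.fst_add, Prod.snd_add, add_zero]
  ring

lemma fwdDiff_synthesis_right (hU : SchurFamily U θ) (hW : SchurFamily W η) (hc : QuarterGrowth c)
    (h : ℝ) : _root_.fwdDiff ((0 : ℝ), h) (synthesis c U W) =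
      synthesis c U (fun j m => _root_.fwdDiff h (W j m)) := by
  ext x
  unfold synthesis
  rw [_root_.fwdDiff, ← (hU.summable_levelSum hW hc _).tsum_sub (hU.summable_levelSum hW hc _)]
  refine tsum_congr fun k => ?_
  unfold levelSum
  rw [← Finset.sum_sub_distrib]
  refine Finset.sum_congr rfl fun m _ => ?_
  simp only [_root_.fwdDiff, Prod.fst_add, Prod.snd_add, add_zero]
  ring

lemma fwdDiff_iterate_synthesis_left (hU : SchurFamily U θ) (hW : SchurFamily W η)
    (hc : QuarterGrowth c) (h : ℝ) (l : ℕ) :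
    (_root_.fwdDiff (h, (0 : ℝ)))^[l] (synthesis c U W) =
      synthesis c (fun j m => (_root_.fwdDiff h)^[l] (U j m)) W := by
  induction l generalizing U θ with
  | zero => rfl
  | succ l ih =>
    rw [Function.iterate_succ_apply, hU.fwdDiff_synthesis_left hW hc, ih (hU.fwdDiff h)]
    rfl

lemma fwdDiff_iterate_synthesis_right (hU : SchurFamily U θ) (hW : SchurFamily W η)
    (hc : QuarterGrowth c) (h : ℝ) (l : ℕ) :
    (_root_.fwdDiff ((0 : ℝ), h))^[l] (synthesis c U W) =
      synthesis c U (fun j m => (_root_.fwdDiff h)^[l] (W j m)) := by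
  induction l generalizing W η with
  | zero => rfl
  | succ l ih =>
    rw [Function.iterate_succ_apply, hU.fwdDiff_synthesis_right hW hc, ih (hW.fwdDiff h)]
    rfl

/-- Only the first difference is used for the gain in h; each further one costs a factor 2. -/
lemma fwdDiff_iterate {h : ℝ} (hU : SchurFamily (fun j m => _root_.fwdDiff h (U j m)) θ) {l : ℕ}
    (hl : 1 ≤ l) :
    SchurFamily (fun j m => (_root_.fwdDiff h)^[l] (U j m)) (fun j => 2 ^ (l - 1) * θ j) := by
  induction l, hl using Nat.le_induction with
  | base => simpa using hU
  | succ l hl ih =>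
    have h1 := ih.fwdDiff h
    simp_rw [← Function.iterate_succ_apply' (_root_.fwdDiff h)] at h1
    obtain ⟨n, rfl⟩ := Nat.exists_eq_add_of_le' hl
    simpa [pow_succ', mul_assoc] using h1

end SchurFamily

/-! ### The extension of the Faber system to the plane -/

/-- The translation parameter of the hat function which extends `v_{j,m}` to the real line. -/
noncomputable def offset (j : ℤ) (m : ℕ) : ℝ := if j = -1 then ((m : ℝ) - 1) / 2 else m

/-- The hat function which extends `v_{j,m}` to the real line (and `0` if `j < -1`). -/
noncomputable def extHat (j : ℤ) (m : ℕ) (t : ℝ) : ℝ :=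
  if j < -1 then 0 else hat ((2 : ℝ) ^ j * t - offset j m)

/-- The interval in which `extHat j m` does not vanish. -/
def extSupport (j : ℤ) (m : ℕ) : Set ℝ :=
  Set.Ioo (((2 : ℝ) ^ j)⁻¹ * offset j m) (((2 : ℝ) ^ j)⁻¹ * (offset j m + 1))

/-- At level -1 the functions 1 - t and t are the falling half of hat((t+1)/2) and the rising half
of hat(t/2), which explains the offsets -1/2 and 0. -/
lemma extHat_eq_faber {j : ℤ} (hj : -1 ≤ j) {m : ℕ} (hm : m ∈ translations j) {t : ℝ}
    (ht : t ∈ Set.Icc (0 : ℝ) 1) : extHat j m t = faber j m t := by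
  obtain ⟨h0, h1⟩ := ht
  unfold extHat faber offset
  rw [if_neg (by omega)]
  by_cases h : j = -1
  · have hm2 : m < 2 := by simpa [translations, h] using hm
    simp only [h, if_true, zpow_neg_one]
    interval_cases m
    · rw [hat_of_half_le (by norm_num; linarith) (by norm_num; linarith)]
      norm_num
      ring
    · rw [hat_of_le_half (by norm_num; linarith) (by norm_num; linarith)]
      norm_num
      ring
  · simp [h]

/-! ### Size, differences and supports of the extended hats -/

lemma abs_hat_sub_le (s t : ℝ) : |hat s - hat t| ≤ 2 * |s - t| := by
  unfold hat
  rw [max_comm 0, max_comm 0]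
  refine (abs_max_sub_max_le_abs _ _ _).trans ?_
  rw [sub_sub_sub_cancel_left]
  refine (abs_abs_sub_abs_le (2 * t - 1) (2 * s - 1)).trans (le_of_eq ?_)
  rw [show 2 * t - 1 - (2 * s - 1) = 2 * (t - s) by ring, abs_mul, abs_two, abs_sub_comm]

lemma extHat_nonneg (j : ℤ) (m : ℕ) (t : ℝ) : 0 ≤ extHat j m t := by
  unfold extHat
  split_ifs
  · exact le_rfl
  · exact hat_nonneg _

lemma extHat_le_one (j : ℤ) (m : ℕ) (t : ℝ) : extHat j m t ≤ 1 := by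
  unfold extHat
  split_ifs
  · exact zero_le_one
  · exact hat_le_one _

lemma extHat_eq_zero {j : ℤ} {m : ℕ} {t : ℝ} (ht : t ∉ extSupport j m) : extHat j m t = 0 := by
  unfold extHat
  have hN : (0 : ℝ) < 2 ^ j := by positivity
  unfold extSupport at ht
  rw [Set.mem_Ioo, inv_mul_lt_iff₀ hN, lt_inv_mul_iff₀ hN, not_and_or, not_lt, not_lt] at ht
  split_ifs
  · rfl
  · rcases ht with h | h
    · exact hat_eq_zero_of_nonpos (by linarith)
    · exact hat_eq_zero_of_one_le (by linarith)

/-- The bound 1 serves steps longer than the mesh, the Lipschitz bound shorter ones; this dichotomy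
produces the smoothness. -/
lemma abs_extHat_sub_le (j : ℤ) (m : ℕ) (s t : ℝ) :
    |extHat j m s - extHat j m t| ≤ min 1 (2 * (2 : ℝ) ^ j * |s - t|) := by
  have hs := extHat_nonneg j m s
  have ht := extHat_nonneg j m t
  refine le_min (abs_sub_le_iff.2 ⟨?_, ?_⟩) ?_
  · linarith [extHat_le_one j m s]
  · linarith [extHat_le_one j m t]
  · unfold extHat
    split_ifs
    · simp
      positivity
    · refine (abs_hat_sub_le _ _).trans (le_of_eq ?_)
      rw [sub_sub_sub_cancel_right, ← mul_sub, abs_mul, abs_of_pos (by positivity : (0 : ℝ) < 2 ^ j)]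
      ring

lemma measurable_extHat (j : ℤ) (m : ℕ) : Measurable (extHat j m) := by
  unfold extHat hat
  split_ifs <;> fun_prop

lemma sum_indicator_extSupport_le (j : ℤ) (t : ℝ) :
    ∑ m ∈ translations j, (extSupport j m).indicator (fun _ => (1 : ℝ)) t ≤ 2 := by
  classical
  have hN : (0 : ℝ) < 2 ^ j := by positivity
  simp_rw [Set.indicator_apply]
  rw [← Finset.sum_filter, Finset.sum_const, nsmul_eq_mul, mul_one]
  norm_cast
  by_cases hj : j = -1
  · refine (Finset.card_filter_le _ _).trans ?_
    simp [translations, hj]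
  · refine (Finset.card_le_card fun m hm => ?_).trans (card_filter_dyadic_le j t)
    rw [Finset.mem_filter] at hm ⊢
    refine ⟨hm.1, ?_⟩
    have h2 := hm.2
    simp only [extSupport, offset, hj, if_false] at h2
    unfold dyadic
    rw [if_neg hj, zpow_neg]
    exact Set.Ioo_subset_Icc_self h2

lemma volume_extSupport (j : ℤ) (m : ℕ) :
    volume (extSupport j m) = ENNReal.ofReal ((2 : ℝ) ^ (-j)) := by
  unfold extSupport
  rw [Real.volume_Ioo, zpow_neg]
  congr 1
  ring

/-- The functions live on a support and its translate by -h. Each of the two meets a point for at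
most two translations m, which gives the 4 in `SchurFamily`; h = 0 is used for the hats themselves.
-/
lemma schurFamily_of_le {U : ℤ → ℕ → ℝ → ℝ} {ρ : ℤ → ℝ} (hm : ∀ j m, Measurable (U j m))
    (h0 : ∀ j < -1, ∀ m x, U j m x = 0) (hρ0 : ∀ j, 0 ≤ ρ j) (hρ1 : ∀ j, ρ j ≤ 1) (h : ℝ)
    (hU : ∀ j m x, |U j m x| ≤ ρ j) (hU' : ∀ j m x, x ∉ extSupport j m → x + h ∉ extSupport j m →
      U j m x = 0) :
    SchurFamily U ρ := by
  have key : ∀ j m x, |U j m x| ≤ ρ j * ((extSupport j m).indicator (fun _ => (1 : ℝ)) (x + h) +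
      (extSupport j m).indicator (fun _ => (1 : ℝ)) x) := fun j m x => by
    by_cases h1 : x ∈ extSupport j m <;> by_cases h2 : x + h ∈ extSupport j m
    · simp only [h1, h2, Set.indicator_of_mem]
      linarith [hU j m x, hρ0 j]
    · simpa [h1, h2] using hU j m x
    · simpa [h1, h2] using hU j m x
    · simp [h1, h2, hU' j m x h1 h2]
  refine ⟨hm, fun j x => ?_, fun j m => ?_, h0, 1, hρ1⟩
  · refine (Finset.sum_le_sum fun m _ => key j m x).trans ?_
    rw [← Finset.mul_sum, Finset.sum_add_distrib, mul_comm 4]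
    refine mul_le_mul_of_nonneg_left ?_ (hρ0 j)
    linarith [sum_indicator_extSupport_le j (x + h), sum_indicator_extSupport_le j x]
  · have hmeas : MeasurableSet (extSupport j m) := measurableSet_Ioo
    have hi : Measurable ((extSupport j m).indicator fun _ => (1 : ℝ≥0∞)) :=
      measurable_const.indicator hmeas
    have hle : ∀ x, ‖U j m x‖ₑ ≤ ENNReal.ofReal (ρ j) *
        ((extSupport j m).indicator (fun _ => (1 : ℝ≥0∞)) (x + h) +
          (extSupport j m).indicator (fun _ => (1 : ℝ≥0∞)) x) := fun x => by
      rw [Real.enorm_eq_ofReal_abs]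
      refine (ENNReal.ofReal_le_ofReal (key j m x)).trans (le_of_eq ?_)
      rw [ENNReal.ofReal_mul (hρ0 j), ENNReal.ofReal_add
        (Set.indicator_nonneg (fun _ _ => zero_le_one) _)
        (Set.indicator_nonneg (fun _ _ => zero_le_one) _)]
      have e : ∀ y, ENNReal.ofReal ((extSupport j m).indicator (fun _ => (1 : ℝ)) y) =
          (extSupport j m).indicator (fun _ => (1 : ℝ≥0∞)) y := fun y => by
        by_cases hy : y ∈ extSupport j m <;> simp [hy]
      rw [e, e]
    calc _ ≤ ∫⁻ x, ENNReal.ofReal (ρ j) *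
        ((extSupport j m).indicator (fun _ => (1 : ℝ≥0∞)) (x + h) +
          (extSupport j m).indicator (fun _ => (1 : ℝ≥0∞)) x) := lintegral_mono hle
      _ = ENNReal.ofReal (ρ j) * (ENNReal.ofReal ((2 : ℝ) ^ (-j)) +
          ENNReal.ofReal ((2 : ℝ) ^ (-j))) := by
          rw [lintegral_const_mul' _ _ ENNReal.ofReal_ne_top, lintegral_add_right _ hi,
            lintegral_add_right_eq_self ((extSupport j m).indicator fun _ => (1 : ℝ≥0∞)) h,
            lintegral_indicator_const hmeas, one_mul, volume_extSupport]
      _ ≤ _ := by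
          have := hρ0 j
          rw [← ENNReal.ofReal_add (by positivity) (by positivity), ← ENNReal.ofReal_mul this]
          apply ENNReal.ofReal_le_ofReal
          have : 0 ≤ ρ j * (2 : ℝ) ^ (-j) := by positivity
          nlinarith

lemma schurFamily_extHat :
    SchurFamily extHat ((Set.Ici (-1 : ℤ)).indicator fun _ => 1) := by
  refine schurFamily_of_le measurable_extHat (fun j hj m x => by simp [extHat, hj])
    (fun j => Set.indicator_nonneg (fun _ _ => zero_le_one) j)
    (fun j => Set.indicator_le_self' (fun _ _ => zero_le_one) j) 0 (fun j m x => ?_)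
    fun j m x hx _ => extHat_eq_zero hx
  by_cases hj : -1 ≤ j
  · rw [Set.indicator_of_mem (show j ∈ Set.Ici (-1 : ℤ) from hj), abs_of_nonneg (extHat_nonneg _ _ _)]
    exact extHat_le_one _ _ _
  · have : j < -1 := by omega
    simp [extHat, this]

lemma schurFamily_fwdDiff_extHat (h : ℝ) :
    SchurFamily (fun j m => fwdDiff h (extHat j m)) (fun j => min 1 (2 * (2 : ℝ) ^ j * |h|)) := by
  refine schurFamily_of_le (fun j m => ?_) (fun j hj m x => by simp [fwdDiff, extHat, hj])
    (fun j => by positivity) (fun j => min_le_left _ _) h (fun j m x => ?_) fun j m x h1 h2 => ?_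
  · have := measurable_extHat j m
    unfold fwdDiff
    fun_prop
  · simpa [fwdDiff] using abs_extHat_sub_le j m (x + h) x
  · simp [fwdDiff, extHat_eq_zero h1, extHat_eq_zero h2]

lemma tsum_levels_ne_top :
    ∑' j : ℤ, ENNReal.ofReal ((2 : ℝ) ^ (-(j : ℝ) * (1 / 2)) *
      (4 * (Set.Ici (-1 : ℤ)).indicator (fun _ => (1 : ℝ)) j)) ≠ ∞ := by
  refine Summable.tsum_ofReal_ne_top
    (((summable_indicator_rpow (r := 1 / 2) (by norm_num)).mul_left 4).congr fun j => ?_)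
  by_cases hj : -1 ≤ j <;> simp [hj, mul_comm]

/-- The smoothness one half of the sum over all levels of the bounds for differences. -/
lemma exists_tsum_fwdDiff_le : ∃ C : ℝ≥0∞, C ≠ ∞ ∧ ∀ t : ℝ, 0 < t → ∀ h : ℝ, |h| ≤ t →
    ∑' j : ℤ, ENNReal.ofReal ((2 : ℝ) ^ (-(j : ℝ) * (1 / 2)) *
      (4 * min 1 (2 * (2 : ℝ) ^ j * |h|))) ≤ C * ENNReal.ofReal (t ^ (1 / 2 : ℝ)) := by
  set F : ℤ → ℝ := fun i => 16 * (2 : ℝ) ^ (-|(i : ℝ)| * (1 / 2)) with hF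
  have hFs : Summable F := by
    have h1 : Summable fun n : ℕ => (2 : ℝ) ^ (-(n : ℝ) * (1 / 2)) := by
      refine (summable_geometric_of_lt_one (by positivity : (0 : ℝ) ≤ 2 ^ (-(1 / 2) : ℝ))
        (Real.rpow_lt_one_of_one_lt_of_neg one_lt_two (by norm_num))).congr fun n => ?_
      rw [← Real.rpow_natCast, ← Real.rpow_mul zero_le_two]
      ring_nf
    refine Summable.mul_left 16 (Summable.of_nat_of_neg ?_ ?_)
    · simpa using h1
    · simpa using h1
  refine ⟨∑' i, ENNReal.ofReal (F i), hFs.tsum_ofReal_ne_top, fun t ht h hh => ?_⟩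
  -- With 2^J ≤ t < 2^{J+1} and i = j + J, the mesh 2^{-j} is comparable to t at i = 0. For i ≥ 0
  -- the bound 1 in the minimum leaves 2^{-i/2}; for i ≤ 0 the Lipschitz bound leaves 2^{i/2}.
  obtain ⟨J, hJ1, hJ2⟩ := exists_mem_Ico_zpow ht (one_lt_two (α := ℝ))
  rw [← (Equiv.addRight J).tsum_eq fun i => ENNReal.ofReal (F i), ← ENNReal.tsum_mul_right]
  refine ENNReal.tsum_le_tsum fun j => ?_
  rw [← ENNReal.ofReal_mul (by positivity)]
  apply ENNReal.ofReal_le_ofReal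
  simp only [Equiv.coe_addRight, hF]
  have hJt : (2 : ℝ) ^ ((J : ℝ) * (1 / 2)) ≤ t ^ (1 / 2 : ℝ) := by
    rw [Real.rpow_mul zero_le_two, Real.rpow_intCast]
    gcongr
  have hsplit : (2 : ℝ) ^ (-(j : ℝ) * (1 / 2)) =
      (2 : ℝ) ^ (-((j + J : ℤ) : ℝ) * (1 / 2)) * (2 : ℝ) ^ ((J : ℝ) * (1 / 2)) := by
    rw [← Real.rpow_add two_pos]
    push_cast
    ring_nf
  have hθ : 2 * (2 : ℝ) ^ j * |h| ≤ 4 * (2 : ℝ) ^ ((j + J : ℤ) : ℝ) := by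
    have h2 : |h| ≤ (2 : ℝ) ^ J * 2 := by
      rw [← zpow_add_one₀ two_ne_zero]
      exact hh.trans hJ2.le
    rw [Real.rpow_intCast, zpow_add₀ two_ne_zero]
    calc _ ≤ 2 * (2 : ℝ) ^ j * ((2 : ℝ) ^ J * 2) := by gcongr
      _ = _ := by ring
  have hmain : (2 : ℝ) ^ (-((j + J : ℤ) : ℝ) * (1 / 2)) * (4 * min 1 (2 * (2 : ℝ) ^ j * |h|)) ≤
      16 * (2 : ℝ) ^ (-|((j + J : ℤ) : ℝ)| * (1 / 2)) := by
    rcases le_total 0 ((j + J : ℤ) : ℝ) with h0 | h0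
    · rw [abs_of_nonneg h0]
      have := min_le_left 1 (2 * (2 : ℝ) ^ j * |h|)
      nlinarith [Real.rpow_pos_of_pos two_pos (-((j + J : ℤ) : ℝ) * (1 / 2))]
    · rw [abs_of_nonpos h0]
      calc _ ≤ (2 : ℝ) ^ (-((j + J : ℤ) : ℝ) * (1 / 2)) * (4 * (4 * (2 : ℝ) ^ ((j + J : ℤ) : ℝ))) := by
            gcongr
            exact (min_le_right _ _).trans hθ
        _ = 16 * ((2 : ℝ) ^ (-((j + J : ℤ) : ℝ) * (1 / 2)) * (2 : ℝ) ^ ((j + J : ℤ) : ℝ)) := by ring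
        _ = _ := by
            rw [← Real.rpow_add two_pos]
            ring_nf
  rw [hsplit, mul_right_comm]
  refine mul_le_mul hmain hJt (by positivity) (by positivity)

/-! ### Bounds for the coefficients from exponential means -/

/-- For |y| ≥ 1 the n-th term of the exponential series, with n = ⌈p⌉, dominates because p ≤ 2n. -/
lemma exists_rpow_le_exp_sq (p : ℝ) (hp : 0 ≤ p) :
    ∃ C : ℝ, 0 ≤ C ∧ ∀ y : ℝ, |y| ^ p ≤ C * Real.exp (y ^ 2 / 16) := by
  set n := ⌈p⌉₊
  have hf : (1 : ℝ) ≤ n.factorial := by exact_mod_cast n.factorial_pos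
  refine ⟨16 ^ n * n.factorial, by positivity, fun y => ?_⟩
  rcases le_total |y| 1 with h | h
  · calc |y| ^ p ≤ 1 := Real.rpow_le_one (abs_nonneg _) h hp
      _ ≤ _ := one_le_mul_of_one_le_of_one_le (one_le_mul_of_one_le_of_one_le
        (one_le_pow₀ (by norm_num)) hf) (Real.one_le_exp (by positivity))
  · have h1 := Real.pow_div_factorial_le_exp (y ^ 2 / 16) (by positivity) n
    rw [div_le_iff₀ (by positivity), div_pow, div_le_iff₀ (by positivity)] at h1
    calc |y| ^ p ≤ |y| ^ ((2 * n : ℕ) : ℝ) := by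
          apply Real.rpow_le_rpow_of_exponent_le h
          push_cast
          linarith [Nat.le_ceil p, (Nat.cast_nonneg n : (0 : ℝ) ≤ n)]
      _ = (y ^ 2) ^ n := by rw [Real.rpow_natCast, pow_mul, sq_abs]
      _ ≤ _ := by linarith

lemma zpow_neg_le_cellVol {k : ℤ × ℤ} (hk : k ∈ levels) :
    (2 : ℝ) ^ (-(k.1 + k.2)) ≤ 4 * cellVol k := by
  have h : ∀ j : ℤ, -1 ≤ j → (2 : ℝ) ^ (-j) ≤ 2 * (1 / 2) ^ j.toNat := fun j hj => by
    by_cases hj' : j = -1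
    · simp [hj']
    · obtain ⟨n, rfl⟩ := Int.eq_ofNat_of_zero_le (show 0 ≤ j by omega)
      have : (0 : ℝ) < (2 ^ n)⁻¹ := by positivity
      rw [zpow_neg, zpow_natCast, Int.toNat_natCast, one_div, inv_pow]
      linarith
  unfold cellVol
  rw [neg_add, zpow_add₀ two_ne_zero]
  calc _ ≤ (2 * (1 / 2 : ℝ) ^ k.1.toNat) * (2 * (1 / 2) ^ k.2.toNat) :=
        mul_le_mul (h _ hk.1) (h _ hk.2) (by positivity) (by positivity)
    _ = _ := by ring

lemma exists_moment_le {c : ℤ × ℤ → ℕ × ℕ → ℝ} {M : ℝ} (hM : 1 ≤ M)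
    (hc : ∀ k ∈ levels, expMean c k ≤ M) {p : ℝ} (hp : 1 ≤ p) :
    ∃ A : ℝ, 0 ≤ A ∧ ∀ k ∈ levels,
      (2 : ℝ) ^ (-(k.1 + k.2)) * ∑ m ∈ translations₂ k, |c k m| ^ p ≤ A ^ p := by
  obtain ⟨C, hC0, hC⟩ := exists_rpow_le_exp_sq p (by linarith)
  refine ⟨(4 * C * M) ^ p⁻¹, by positivity, fun k hk => ?_⟩
  rw [← Real.rpow_mul (by positivity), inv_mul_cancel₀ (by linarith), Real.rpow_one]
  have hV := cellVol_pos k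
  calc _ ≤ 4 * cellVol k * ∑ m ∈ translations₂ k, C * Real.exp ((c k m) ^ 2 / 16) := by
        gcongr with m _
        · exact zpow_neg_le_cellVol hk
        · exact hC _
    _ = 4 * C * expMean c k := by
        unfold expMean
        rw [← Finset.mul_sum]
        ring
    _ ≤ _ := by
        gcongr
        exact hc k hk

/-- A single term of the bounded fourth power mean; the exponent 1/4 lies below the 1/2 needed for
summability. -/
lemma quarterGrowth_of_expMean_le {c : ℤ × ℤ → ℕ × ℕ → ℝ} {M : ℝ} (hM : 1 ≤ M)
    (hc : ∀ k ∈ levels, expMean c k ≤ M) : QuarterGrowth c := by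
  obtain ⟨A, hA0, hA⟩ := exists_moment_le hM hc (p := 4) (by norm_num)
  refine ⟨A, fun k hk m hm => ?_⟩
  have h1 : (2 : ℝ) ^ (-(k.1 + k.2)) * |c k m| ^ (4 : ℝ) ≤ A ^ (4 : ℝ) := by
    refine le_trans ?_ (hA k hk)
    gcongr
    exact Finset.single_le_sum (f := fun m => |c k m| ^ (4 : ℝ)) (fun _ _ => by positivity) hm
  rw [zpow_neg, inv_mul_le_iff₀ (by positivity)] at h1
  refine (Real.rpow_le_rpow_iff (abs_nonneg _) (by positivity)
    (by norm_num : (0 : ℝ) < 4)).1 (h1.trans (le_of_eq ?_))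
  rw [Real.mul_rpow hA0 (by positivity), ← Real.rpow_mul zero_le_two, mul_assoc,
    one_div_mul_cancel (by norm_num), mul_one, Real.rpow_intCast, mul_comm]

/-! ### The Besov space -/

lemma synthesis_eq_of_hasFaberExpansion {f : I × I → ℝ} {c : ℤ × ℤ → ℕ × ℕ → ℝ}
    (hf : HasFaberExpansion (1 / 2) f c) (hc : QuarterGrowth c) (x : I × I) :
    synthesis c extHat extHat ((x.1 : ℝ), (x.2 : ℝ)) = f x := by
  set y : ℝ × ℝ := ((x.1 : ℝ), (x.2 : ℝ))
  have hs := (schurFamily_extHat.summable_levelSum schurFamily_extHat hc y).hasSum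
  -- The `tsum` runs over all of ℤ², so the squares are enlarged below -1, where every level
  -- vanishes, in order to exhaust it.
  have hu : Tendsto (fun K : ℕ => Finset.Icc (-(K : ℤ) - 1) K ×ˢ Finset.Icc (-(K : ℤ) - 1) K)
      atTop atTop := by
    refine tendsto_atTop_finset_of_monotone (fun K L hKL => ?_) fun k => ?_
    · have : (K : ℤ) ≤ L := by exact_mod_cast hKL
      exact Finset.product_subset_product (Finset.Icc_subset_Icc (by omega) this)
        (Finset.Icc_subset_Icc (by omega) this)
    · refine ⟨max k.1.natAbs k.2.natAbs, ?_⟩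
      simp only [Finset.mem_product, Finset.mem_Icc]
      omega
  have h1 := hs.comp hu
  refine tendsto_nhds_unique h1 ((hf.tendsto_at x).congr fun K => ?_)
  simp only [Function.comp_apply]
  unfold faberSum
  rw [← Finset.sum_subset (Finset.product_subset_product
    (Finset.Icc_subset_Icc (show -(K : ℤ) - 1 ≤ -1 by omega) (le_refl (K : ℤ)))
    (Finset.Icc_subset_Icc (show -(K : ℤ) - 1 ≤ -1 by omega) (le_refl (K : ℤ))))]
  · refine Finset.sum_congr rfl fun k hk => Finset.sum_congr rfl fun m hm => ?_
    simp only [Finset.mem_product, Finset.mem_Icc] at hk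
    have hm' := Finset.mem_product.1 hm
    rw [faber₂, extHat_eq_faber hk.1.1 hm'.1 x.1.2, extHat_eq_faber hk.2.1 hm'.2 x.2.2]
  · intro k hk hk'
    refine schurFamily_extHat.levelSum_eq_zero schurFamily_extHat (fun hl => hk' ?_) y
    simp only [Finset.mem_product, Finset.mem_Icc] at hk ⊢
    exact ⟨⟨hl.1, hk.1.2⟩, hl.2, hk.2.2⟩

/-- The sum over all levels of the bounds for differences of order `l`. -/
lemma exists_tsum_fwdDiff_iterate_le (l : ℕ) : ∃ C : ℝ≥0∞, C ≠ ∞ ∧ ∀ t : ℝ, 0 < t → ∀ h : ℝ,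
    |h| ≤ t → ∑' j : ℤ, ENNReal.ofReal ((2 : ℝ) ^ (-(j : ℝ) * (1 / 2)) *
      (4 * (2 ^ (l - 1) * min 1 (2 * (2 : ℝ) ^ j * |h|)))) ≤
        C * ENNReal.ofReal (t ^ (1 / 2 : ℝ)) := by
  obtain ⟨C, hC, H⟩ := exists_tsum_fwdDiff_le
  refine ⟨ENNReal.ofReal (2 ^ (l - 1)) * C, ENNReal.mul_ne_top ENNReal.ofReal_ne_top hC,
    fun t ht h hh => ?_⟩
  rw [mul_assoc]
  refine le_trans (le_of_eq ?_) (mul_le_mul_right (H t ht h hh) _)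
  rw [← ENNReal.tsum_mul_left]
  refine tsum_congr fun j => ?_
  rw [← ENNReal.ofReal_mul (by positivity)]
  ring_nf

lemma ofReal_rpow_neg_mul {t : ℝ} (ht : 0 < t) :
    ENNReal.ofReal (t ^ (-(1 / 2) : ℝ)) * ENNReal.ofReal (t ^ (1 / 2 : ℝ)) = 1 := by
  rw [← ENNReal.ofReal_mul (by positivity), ← Real.rpow_add ht]
  simp

/-- The synthesis with extended hats is the function on the plane. In each term of the norm, a
variable contributes the finite sum N if it is not differenced and C t^{1/2} if it is, and the
weight t^{-1/2} cancels the latter. -/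
theorem mem_mixedBesovSpace {f : I × I → ℝ} {c : ℤ × ℤ → ℕ × ℕ → ℝ}
    (hf : HasFaberExpansion (1 / 2) f c) {M : ℝ} (hM : 1 ≤ M)
    (hc : ∀ k ∈ levels, expMean c k ≤ M) {p : ℝ≥0∞} (hp : 1 ≤ p) (hp' : p ≠ ∞) {l : ℕ}
    (hl : 1 ≤ l) : f ∈ mixedBesovSpace (1 / 2) p l := by
  have hq := quarterGrowth_of_expMean_le hM hc
  have hE := schurFamily_extHat
  obtain ⟨A, hA0, hA⟩ := exists_moment_le hM hc (p := p.toReal) (by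
    rw [← ENNReal.toReal_one]
    exact ENNReal.toReal_mono hp' hp)
  obtain ⟨C, hC, H⟩ := exists_tsum_fwdDiff_iterate_le l
  set N := ∑' j : ℤ, ENNReal.ofReal ((2 : ℝ) ^ (-(j : ℝ) * (1 / 2)) *
      (4 * (Set.Ici (-1 : ℤ)).indicator (fun _ => (1 : ℝ)) j)) with hN
  have hNt : N ≠ ∞ := tsum_levels_ne_top
  have hD : ∀ h : ℝ, SchurFamily (fun j m => (fwdDiff h)^[l] (extHat j m)) _ := fun h =>
    (schurFamily_fwdDiff_extHat h).fwdDiff_iterate hl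
  refine ⟨synthesis c extHat extHat, (hE.measurable_synthesis hE).aestronglyMeasurable, ?_,
    ae_of_all _ fun x => (synthesis_eq_of_hasFaberExpansion hf hq x).symm⟩
  unfold mixedBesovNorm
  refine ENNReal.add_lt_top.2 ⟨ENNReal.add_lt_top.2 ⟨ENNReal.add_lt_top.2 ⟨?_, ?_⟩, ?_⟩, ?_⟩
  · refine (hE.eLpNorm_synthesis_le hE hq hp hp' hA0 hA).trans_lt (Ne.lt_top ?_)
    exact ENNReal.mul_ne_top (ENNReal.mul_ne_top hNt hNt) ENNReal.ofReal_ne_top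
  · refine lt_of_le_of_lt (b := C * N * ENNReal.ofReal A) (iSup₂_le fun t ht => ?_)
      (Ne.lt_top (ENNReal.mul_ne_top (ENNReal.mul_ne_top hC hNt) ENNReal.ofReal_ne_top))
    simp_rw [ENNReal.mul_iSup]
    refine iSup₂_le fun h hh => ?_
    rw [hE.fwdDiff_iterate_synthesis_left hE hq]
    calc _ ≤ ENNReal.ofReal (t ^ (-(1 / 2) : ℝ)) *
          (C * ENNReal.ofReal (t ^ (1 / 2 : ℝ)) * N * ENNReal.ofReal A) := by
          gcongr
          refine ((hD h).eLpNorm_synthesis_le hE hq hp hp' hA0 hA).trans ?_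
          gcongr
          exact H t ht.1 h hh
      _ = (ENNReal.ofReal (t ^ (-(1 / 2) : ℝ)) * ENNReal.ofReal (t ^ (1 / 2 : ℝ))) *
          (C * N * ENNReal.ofReal A) := by ring
      _ = _ := by rw [ofReal_rpow_neg_mul ht.1, one_mul]
  · refine lt_of_le_of_lt (b := N * C * ENNReal.ofReal A) (iSup₂_le fun t ht => ?_)
      (Ne.lt_top (ENNReal.mul_ne_top (ENNReal.mul_ne_top hNt hC) ENNReal.ofReal_ne_top))
    simp_rw [ENNReal.mul_iSup]
    refine iSup₂_le fun h hh => ?_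
    rw [hE.fwdDiff_iterate_synthesis_right hE hq]
    calc _ ≤ ENNReal.ofReal (t ^ (-(1 / 2) : ℝ)) *
          (N * (C * ENNReal.ofReal (t ^ (1 / 2 : ℝ))) * ENNReal.ofReal A) := by
          gcongr
          refine (hE.eLpNorm_synthesis_le (hD h) hq hp hp' hA0 hA).trans ?_
          gcongr
          exact H t ht.1 h hh
      _ = (ENNReal.ofReal (t ^ (-(1 / 2) : ℝ)) * ENNReal.ofReal (t ^ (1 / 2 : ℝ))) *
          (N * C * ENNReal.ofReal A) := by ring
      _ = _ := by rw [ofReal_rpow_neg_mul ht.1, one_mul]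
  · refine lt_of_le_of_lt (b := C * C * ENNReal.ofReal A)
      (iSup₂_le fun t₁ ht₁ => iSup₂_le fun t₂ ht₂ => ?_)
      (Ne.lt_top (ENNReal.mul_ne_top (ENNReal.mul_ne_top hC hC) ENNReal.ofReal_ne_top))
    simp_rw [ENNReal.mul_iSup]
    refine iSup₂_le fun h₁ hh₁ => iSup₂_le fun h₂ hh₂ => ?_
    rw [hE.fwdDiff_iterate_synthesis_left hE hq, (hD h₁).fwdDiff_iterate_synthesis_right hE hq]
    calc _ ≤ ENNReal.ofReal ((t₁ * t₂) ^ (-(1 / 2) : ℝ)) *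
          (C * ENNReal.ofReal (t₁ ^ (1 / 2 : ℝ)) * (C * ENNReal.ofReal (t₂ ^ (1 / 2 : ℝ))) *
            ENNReal.ofReal A) := by
          gcongr
          refine ((hD h₁).eLpNorm_synthesis_le (hD h₂) hq hp hp' hA0 hA).trans ?_
          gcongr
          · exact H t₁ ht₁.1 h₁ hh₁
          · exact H t₂ ht₂.1 h₂ hh₂
      _ = (ENNReal.ofReal (t₁ ^ (-(1 / 2) : ℝ)) * ENNReal.ofReal (t₁ ^ (1 / 2 : ℝ))) *
          (ENNReal.ofReal (t₂ ^ (-(1 / 2) : ℝ)) * ENNReal.ofReal (t₂ ^ (1 / 2 : ℝ))) *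
          (C * C * ENNReal.ofReal A) := by
          have h0 : 0 ≤ t₁ ^ (-(1 / 2) : ℝ) := Real.rpow_nonneg ht₁.1.le _
          rw [Real.mul_rpow ht₁.1.le ht₂.1.le, ENNReal.ofReal_mul h0]
          ring
      _ = _ := by rw [ofReal_rpow_neg_mul ht₁.1, ofReal_rpow_neg_mul ht₂.1, one_mul, one_mul]

end BrownianSheet

theorem mainTheorem10 {Ω : Type*} [MeasurableSpace Ω] (P : Measure Ω) [IsProbabilityMeasure P]
    (B : I × I → Ω → ℝ) (hB : BrownianSheet.IsBrownianSheet B P) :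
    ∀ᵐ ω ∂P,
      (fun t : I × I => B t ω) ∈ BrownianSheet.logMixedSpace (1 / 2) ∧
      (∀ p : ℝ≥0∞, 1 ≤ p → p < ∞ → ∀ l : ℕ, 1 ≤ l →
        (fun t : I × I => B t ω) ∈ BrownianSheet.mixedBesovSpace (1 / 2) p l) ∧
      (fun t : I × I => B t ω) ∈ BrownianSheet.orliczMixedSpace := by
  -- The exceptional null set depends neither on p nor on l, since the remaining argument is
  -- deterministic.
  filter_upwards [hB.continuous_paths, hB.exists_expMean_le] with ω hω ⟨M, hM, hc⟩
  have hf := BrownianSheet.hasFaberExpansion_faberCoeff hω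
  exact ⟨⟨hω, _, hf, BrownianSheet.logSeqNorm_lt_top hM hc⟩,
    fun p hp hp' l hl => BrownianSheet.mem_mixedBesovSpace hf hM hc hp hp'.ne hl,
    ⟨hω, _, hf, BrownianSheet.orliczSeqNorm_lt_top hM hc⟩⟩
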